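/- For integers $m,n\ge 1$ write $(m,n)$ for their greatest common divisor, and let $\gamma$ denote the Euler–Mascheroni constant. As $k \to \infty$ through the integers $k \ge 2$, $$ \sup_{1 < n_1 < n_2 < \cdots < n_k} \frac{1}{k (\log\log k)^2} \sum_{i,j=1}^{k} \frac{(n_i, n_j)^2}{n_i n_j} \longrightarrow \frac{6 e^{2\gamma}}{\pi^2}, $$ where, for each $k$, the supremum (which is finite for every $k \ge 2$) is taken over all strictly increasing $k$-term sequences of integers greater than $1$. -/

import Mathlib

/-- The GCD sum `∑_{i,j ≤ k} (n_i, n_j)² / (n_i n_j)` of a `k`-term sequence `n`. -/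
noncomputable def gcdSum {k : ℕ} (n : Fin k → ℕ) : ℝ :=
  ∑ i : Fin k, ∑ j : Fin k, ((Nat.gcd (n i) (n j) : ℝ) ^ 2) / ((n i : ℝ) * (n j : ℝ))

/-- The set of all normalised GCD sums `1 / (k (log log k)²) * ∑_{i,j ≤ k} (n_i, n_j)² / (n_i n_j)`
over the integer sequences `1 < n_1 < ... < n_k`. -/
def normalizedGcdSums (k : ℕ) : Set ℝ :=
  {x : ℝ | ∃ n : Fin k → ℕ, StrictMono n ∧ (∀ i, 1 < n i) ∧
    x = 1 / ((k : ℝ) * (Real.log (Real.log (k : ℝ))) ^ 2) * gcdSum n}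

/-! Encode each `n_i` by its exponent vector `v_i`. The kernel `(n_i, n_j)² / (n_i n_j)` is then `∏
p^(-|v_i(p) - v_j(p)|)`, and each factor is a Fourier coefficient of the Poisson kernel of radius
`1/p`. So the GCD sum is the mean, over a finite-dimensional torus, of a product of Poisson kernels
against `|D|²`, where `D` is a sum of `k` characters with distinct frequencies. Thus `|D|²` has mean
`k` and never exceeds `k²`.

Upper bound (`gcdSum_le`): for `p ≤ y` replace the Poisson kernel by its maximum `(1 + 1/p) / (1 -
1/p)`; these maxima multiply to `poissonEulerProduct y`. The product `W` over `p > y` is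
concentrated near 1: its `(q+1)`-th moment is at most `exp (12 (q+1)² / y)`. Since `W ≤ a + W^(q+1)
/ a^q` for any `a > 0`, fixing `a > 1` and taking `q` and `y` of order `log k` makes the excess
negligible, leaving `poissonEulerProduct y * (a k + 1)`.

Lower bound (`exists_strictMono_le_gcdSum`): on the grid of products `∏ p^(e_p)`, `p ≤ y`, `0 ≤ e_p
< M`, the form factors into Toeplitz sums close to `M (1 + 1/p) / (1 - 1/p)`. Multiplying the grid
by powers of one further prime fills up `k` integers with little loss. Here `y` is about `log k / (4
log log k)`.

Both cutoffs satisfy `log y ~ log log k`. By Mertens' third theorem and `ζ(2) = π²/6`,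
`poissonEulerProduct y = ∏ (1 - p⁻²) (1 - p⁻¹)⁻²` is asymptotic to `(6/π²) e^(2γ) log² y`, so the
two bounds meet. -/

open MeasureTheory in
/-- Continuous functions on a compact space are integrable for a finite measure. -/
theorem Continuous.integrable_of_compactSpace {X E : Type*} [TopologicalSpace X] [CompactSpace X]
    [MeasurableSpace X] [OpensMeasurableSpace X] [NormedAddCommGroup E] {μ : Measure X}
    [IsFiniteMeasureOnCompacts μ] {f : X → E} (hf : Continuous f) : Integrable f μ :=
  hf.integrable_of_hasCompactSupport (HasCompactSupport.of_compactSpace f)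

/-! ### Poisson kernels and the torus integral for the quadratic form. -/

section Poisson

open MeasureTheory AddCircle

theorem fourier_natCast_eq_pow (n : ℕ) (t : UnitAddCircle) :
    fourier (n : ℤ) t = (fourier 1 t : ℂ) ^ n := by
  induction n with
  | zero => simp
  | succ n ih => rw [Nat.cast_succ, fourier_add, ih, pow_succ]

theorem norm_fourier_apply (n : ℤ) (t : UnitAddCircle) : ‖(fourier n t : ℂ)‖ = 1 := by
  rw [fourier_apply]; exact Circle.norm_coe _

/-- The Poisson kernel of the disc at radius `x`, as a function of the angle. -/
noncomputable def poissonKernelAddCircle (x : ℝ) (t : UnitAddCircle) : ℝ :=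
  (1 - x ^ 2) / (1 - 2 * x * (fourier 1 t : ℂ).re + x ^ 2)

theorem abs_re_fourier_one_le (t : UnitAddCircle) : |(fourier 1 t : ℂ).re| ≤ 1 :=
  (Complex.abs_re_le_norm _).trans (norm_fourier_apply 1 t).le

theorem continuous_re_fourier_one : Continuous fun t : UnitAddCircle => (fourier 1 t : ℂ).re :=
  Complex.continuous_re.comp (fourier 1).continuous

theorem poissonKernelAddCircle_denom_pos {x : ℝ} (h1 : x < 1) (h0 : 0 ≤ x) (t : UnitAddCircle) :
    (1 - x) ^ 2 ≤ 1 - 2 * x * (fourier 1 t : ℂ).re + x ^ 2 ∧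
      0 < 1 - 2 * x * (fourier 1 t : ℂ).re + x ^ 2 := by
  have h := (abs_le.1 (abs_re_fourier_one_le t)).2
  have h2 : (1 - x) ^ 2 ≤ 1 - 2 * x * (fourier 1 t : ℂ).re + x ^ 2 := by nlinarith
  exact ⟨h2, lt_of_lt_of_le (by have : 0 < 1 - x := by linarith
                                positivity) h2⟩

theorem continuous_poissonKernelAddCircle {x : ℝ} (h0 : 0 ≤ x) (h1 : x < 1) :
    Continuous (poissonKernelAddCircle x) := by
  unfold poissonKernelAddCircle
  refine Continuous.div continuous_const ?_ fun t =>
    (poissonKernelAddCircle_denom_pos h1 h0 t).2.ne'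
  exact ((continuous_const.sub (continuous_const.mul continuous_re_fourier_one)).add
    continuous_const)

theorem poissonKernelAddCircle_nonneg {x : ℝ} (h0 : 0 ≤ x) (h1 : x < 1) (t : UnitAddCircle) :
    0 ≤ poissonKernelAddCircle x t :=
  div_nonneg (by nlinarith) (poissonKernelAddCircle_denom_pos h1 h0 t).2.le

theorem poissonKernelAddCircle_zero (t : UnitAddCircle) : poissonKernelAddCircle 0 t = 1 := by
  simp [poissonKernelAddCircle]

theorem poissonKernelAddCircle_le {x : ℝ} (h0 : 0 ≤ x) (h1 : x < 1) (t : UnitAddCircle) :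
    poissonKernelAddCircle x t ≤ (1 + x) / (1 - x) := by
  have h : (0 : ℝ) < 1 - x := by linarith
  calc poissonKernelAddCircle x t ≤ (1 - x ^ 2) / (1 - x) ^ 2 :=
        div_le_div_of_nonneg_left (by nlinarith) (by positivity)
          (poissonKernelAddCircle_denom_pos h1 h0 t).1
    _ = (1 + x) / (1 - x) := by field_simp; ring

theorem hasSum_pow_natAbs_mul_fourier {x : ℝ} (h0 : 0 ≤ x) (h1 : x < 1) (t : UnitAddCircle) :
    HasSum (fun n : ℤ => (x : ℂ) ^ n.natAbs * fourier n t) (poissonKernelAddCircle x t : ℂ) := by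
  set z : ℂ := fourier 1 t with hz
  have hz1 : ‖z‖ = 1 := norm_fourier_apply 1 t
  have hzc : z * (starRingEnd ℂ) z = 1 := by
    rw [Complex.mul_conj, Complex.normSq_eq_norm_sq, hz1]; simp
  have hx1 : ‖(x : ℂ) * z‖ < 1 := by
    rw [norm_mul, hz1, Complex.norm_real, Real.norm_of_nonneg h0]; linarith
  have hx2 : ‖(x : ℂ) * (starRingEnd ℂ) z‖ < 1 := by
    rw [norm_mul, RCLike.norm_conj, hz1, Complex.norm_real, Real.norm_of_nonneg h0]; linarith
  have hA := hasSum_geometric_of_norm_lt_one hx1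
  -- The extra factor starts this half of the series at index -1, so that index 0 is counted only
  -- once.
  have hB := (hasSum_geometric_of_norm_lt_one hx2).mul_left ((x : ℂ) * (starRingEnd ℂ) z)
  have hne1 : 1 - (x : ℂ) * z ≠ 0 := fun h => by
    rw [← sub_eq_zero.1 h] at hx1; simp at hx1
  have hne2 : 1 - (x : ℂ) * (starRingEnd ℂ) z ≠ 0 := fun h => by
    rw [← sub_eq_zero.1 h] at hx2; simp at hx2
  have hsum := HasSum.of_nat_of_neg_add_one (f := fun n : ℤ => (x : ℂ) ^ n.natAbs * fourier n t)
    (m := (1 - (x : ℂ) * z)⁻¹)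
    (m' := (x : ℂ) * (starRingEnd ℂ) z * (1 - (x : ℂ) * (starRingEnd ℂ) z)⁻¹)
    (by
      refine hA.congr_fun ?_
      intro n
      simp only [Int.natAbs_natCast]
      rw [fourier_natCast_eq_pow, mul_pow])
    (by
      refine hB.congr_fun ?_
      intro n
      rw [fourier_neg, Int.natAbs_neg]
      rw [show ((n : ℤ) + 1) = ((n + 1 : ℕ) : ℤ) by push_cast; rfl, Int.natAbs_natCast,
        fourier_natCast_eq_pow, map_pow, mul_pow, pow_succ, pow_succ]
      ring)
  convert hsum using 1
  have hre : (2 * x * z.re : ℂ) = x * z + x * (starRingEnd ℂ) z := by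
    rw [← mul_add, Complex.add_conj]; push_cast; ring
  have hden : (1 - 2 * x * z.re + x ^ 2 : ℂ)
      = (1 - (x : ℂ) * z) * (1 - (x : ℂ) * (starRingEnd ℂ) z) := by
    rw [hre]; linear_combination (-(x : ℂ) ^ 2) * hzc
  unfold poissonKernelAddCircle
  push_cast
  rw [← hz, hden]
  field_simp
  linear_combination (x : ℂ) ^ 2 * hzc

theorem integral_fourier_haar (n : ℤ) :
    ∫ t : UnitAddCircle, (fourier n t : ℂ) ∂haarAddCircle = if n = 0 then 1 else 0 := by
  have h := congrFun (fourierCoeff_fourier (T := 1) 0) (-n)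
  simp only [fourierCoeff, neg_neg, smul_eq_mul, fourier_zero, mul_one] at h
  rw [h, Pi.single_apply]
  simp

theorem integral_poissonKernel_mul_fourier {x : ℝ} (h0 : 0 ≤ x) (h1 : x < 1) (m : ℤ) :
    ∫ t : UnitAddCircle, (poissonKernelAddCircle x t : ℂ) * fourier m t ∂haarAddCircle
      = (x : ℂ) ^ m.natAbs := by
  have key : ∀ t : UnitAddCircle, (poissonKernelAddCircle x t : ℂ) * fourier m t
      = ∑' n : ℤ, (x : ℂ) ^ n.natAbs * fourier (n + m) t := fun t => by
    rw [← (hasSum_pow_natAbs_mul_fourier h0 h1 t).tsum_eq, ← tsum_mul_right]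
    simp_rw [fourier_add, mul_assoc]
  simp_rw [key]
  have hnorm : ∀ (n : ℤ) (t : UnitAddCircle),
      ‖(x : ℂ) ^ n.natAbs * fourier (n + m) t‖ = x ^ n.natAbs := fun n t => by
    rw [norm_mul, norm_fourier_apply, norm_pow, Complex.norm_real, Real.norm_of_nonneg h0, mul_one]
  have hs := hasSum_integral_of_summable_integral_norm (μ := haarAddCircle (T := 1))
    (F := fun (n : ℤ) (t : UnitAddCircle) => (x : ℂ) ^ n.natAbs * fourier (n + m) t)
    (fun n => (continuous_const.mul (fourier (n + m)).continuous).integrable_of_compactSpace)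
    (by
      simp_rw [hnorm]
      simp only [integral_const, smul_eq_mul]
      refine Summable.mul_left _ ?_
      refine Summable.of_nat_of_neg ?_ ?_ <;>
      simpa using summable_geometric_of_lt_one h0 h1)
  rw [← hs.tsum_eq]
  simp_rw [integral_const_mul, integral_fourier_haar]
  rw [tsum_eq_single (-m)]
  · simp
  · intro n hn
    rw [if_neg (fun h => hn (by omega)), mul_zero]

/-- Because `(1 - u)(1 + u + 2u²) = 1 + u²(1 - 2u) ≥ 1`. -/
theorem inv_one_sub_le_exp {u : ℝ} (hu : u ≤ 1 / 2) : (1 - u)⁻¹ ≤ Real.exp (u + 2 * u ^ 2) := by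
  have h : 0 < 1 - u := by linarith
  refine le_trans ?_ (Real.add_one_le_exp _)
  rw [inv_le_iff_one_le_mul₀ h]
  nlinarith [mul_nonneg (sq_nonneg u) (sub_nonneg.2 hu)]

/-- The part of the exponent linear in `x` has mean zero over the circle, so moments will only see
terms of order `x²`. The bound `x ≤ 1/5` gives `|u| ≤ 11x/5`, hence `2u² ≤ 10x²`. -/
theorem poissonKernelAddCircle_le_exp {x : ℝ} (h0 : 0 ≤ x) (h1 : x ≤ 1 / 5) (t : UnitAddCircle) :
    poissonKernelAddCircle x t ≤ Real.exp (2 * x * (fourier 1 t : ℂ).re + 10 * x ^ 2) := by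
  set c := (fourier 1 t : ℂ).re with hc
  have hc1 := abs_le.1 (abs_re_fourier_one_le t)
  rw [← hc] at hc1
  have hxc1 : x * c ≤ x := by nlinarith
  have hxc2 : -x ≤ x * c := by nlinarith
  set u := 2 * (x * c) - x ^ 2 with hu
  have hu2 : u ^ 2 ≤ 5 * x ^ 2 := by
    have : |u| ≤ 11 / 5 * x := abs_le.2 ⟨by nlinarith, by nlinarith⟩
    have := sq_le_sq' (abs_le.1 this).1 (abs_le.1 this).2
    nlinarith [sq_nonneg x]
  have hpos := (poissonKernelAddCircle_denom_pos (x := x) (by linarith) h0 t).2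
  rw [← hc] at hpos
  calc poissonKernelAddCircle x t = (1 - x ^ 2) * (1 - u)⁻¹ := by
        unfold poissonKernelAddCircle
        rw [div_eq_mul_inv, ← hc, hu]; ring_nf
    _ ≤ 1 * (1 - u)⁻¹ := by
        refine mul_le_mul_of_nonneg_right (by nlinarith [sq_nonneg x]) (inv_nonneg.2 ?_)
        rw [hu]; linarith
    _ ≤ Real.exp (u + 2 * u ^ 2) := by
        rw [one_mul]; exact inv_one_sub_le_exp (by nlinarith [sq_nonneg x])
    _ ≤ _ := Real.exp_le_exp.2 (by nlinarith [sq_nonneg x])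

theorem integral_re_fourier_one :
    ∫ t : UnitAddCircle, (fourier 1 t : ℂ).re ∂haarAddCircle = 0 := by
  have h := integral_re (𝕜 := ℂ) (μ := haarAddCircle (T := 1)) (f := fun t => (fourier 1 t : ℂ))
    (fourier 1).continuous.integrable_of_compactSpace
  rw [integral_fourier_haar] at h
  simpa using h

/-- The sub-Gaussian estimate for a mean-zero variable in `[-1, 1]`: convexity bounds the
exponential by its chord, and only `cosh s` survives integration. -/
theorem integral_exp_mul_re_fourier_le (s : ℝ) :
    ∫ t : UnitAddCircle, Real.exp (s * (fourier 1 t : ℂ).re) ∂haarAddCircle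
      ≤ Real.exp (s ^ 2 / 2) := by
  calc ∫ t : UnitAddCircle, Real.exp (s * (fourier 1 t : ℂ).re) ∂haarAddCircle
      ≤ ∫ t : UnitAddCircle, (Real.cosh s + (fourier 1 t : ℂ).re * Real.sinh s) ∂haarAddCircle := by
        refine integral_mono ?_ ?_ fun t => by
          rw [mul_comm]
          exact Real.exp_mul_le_cosh_add_mul_sinh (abs_re_fourier_one_le t) s
        · exact (Real.continuous_exp.comp
            (continuous_const.mul continuous_re_fourier_one)).integrable_of_compactSpace
        · exact (continuous_const.add
            (continuous_re_fourier_one.mul continuous_const)).integrable_of_compactSpace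
    _ = Real.cosh s := by
        have hi : Integrable (fun t : UnitAddCircle => (fourier 1 t : ℂ).re * Real.sinh s)
            haarAddCircle :=
          (continuous_re_fourier_one.mul continuous_const).integrable_of_compactSpace
        rw [integral_add (integrable_const _) hi, integral_mul_const, integral_re_fourier_one]
        simp
    _ ≤ _ := Real.cosh_le_exp_half_sq s

theorem integral_poissonKernel_pow_le {x : ℝ} (h0 : 0 ≤ x) (h1 : x ≤ 1 / 5) {q : ℕ} (hq : 1 ≤ q) :
    ∫ t : UnitAddCircle, poissonKernelAddCircle x t ^ q ∂haarAddCircle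
      ≤ Real.exp (12 * (q : ℝ) ^ 2 * x ^ 2) := by
  calc ∫ t : UnitAddCircle, poissonKernelAddCircle x t ^ q ∂haarAddCircle
      ≤ ∫ t : UnitAddCircle, Real.exp (10 * q * x ^ 2) *
          Real.exp ((2 * q * x) * (fourier 1 t : ℂ).re) ∂haarAddCircle := by
        refine integral_mono ?_ ?_ fun t => ?_
        · exact ((continuous_poissonKernelAddCircle h0 (by linarith)).pow
            q).integrable_of_compactSpace
        · exact (continuous_const.mul (Real.continuous_exp.comp
            (continuous_const.mul continuous_re_fourier_one))).integrable_of_compactSpace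
        · calc poissonKernelAddCircle x t ^ q
              ≤ Real.exp (2 * x * (fourier 1 t : ℂ).re + 10 * x ^ 2) ^ q :=
                pow_le_pow_left₀ (poissonKernelAddCircle_nonneg h0 (by linarith) t)
                  (poissonKernelAddCircle_le_exp h0 h1 t) q
            _ = _ := by
                rw [← Real.exp_nat_mul, ← Real.exp_add]; ring_nf
    _ ≤ Real.exp (10 * q * x ^ 2) * Real.exp ((2 * q * x) ^ 2 / 2) := by
        rw [integral_const_mul]
        exact mul_le_mul_of_nonneg_left (integral_exp_mul_re_fourier_le _) (Real.exp_nonneg _)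
    _ ≤ _ := by
        rw [← Real.exp_add, Real.exp_le_exp]
        -- The exponents add up to `10 q x² + 2 q² x²`, and `q ≤ q²`.
        have hq' : (1 : ℝ) ≤ q := by exact_mod_cast hq
        have : (q : ℝ) * x ^ 2 ≤ (q : ℝ) ^ 2 * x ^ 2 :=
          mul_le_mul_of_nonneg_right (by nlinarith) (sq_nonneg x)
        nlinarith

/-- The uniform probability measure on the torus with index set `ι`. -/
noncomputable abbrev torusMeasure (ι : Type*) [Fintype ι] : Measure (ι → UnitAddCircle) :=
  Measure.pi fun _ => haarAddCircle

/-- The trigonometric polynomial with frequencies `v i`. -/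
noncomputable def trigSum {ι κ : Type*} [Fintype ι] [Fintype κ] (v : κ → ι → ℤ)
    (θ : ι → UnitAddCircle) : ℂ :=
  ∑ i, ∏ p, fourier (v i p) (θ p)

theorem continuous_trigSum {ι κ : Type*} [Fintype ι] [Fintype κ]
    (v : κ → ι → ℤ) : Continuous (trigSum v) := by
  unfold trigSum
  exact continuous_finsetSum _ fun i _ => continuous_finsetProd _ fun p _ =>
    (fourier (v i p)).continuous.comp (continuous_apply p)

theorem norm_trigSum_le {ι κ : Type*} [Fintype ι] [Fintype κ]
    (v : κ → ι → ℤ) (θ : ι → UnitAddCircle) :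
    ‖trigSum v θ‖ ≤ Fintype.card κ := by
  unfold trigSum
  refine (norm_sum_le _ _).trans ?_
  simp only [norm_prod, norm_fourier_apply]
  simp

theorem continuous_prod_poissonKernel {ι : Type*} {x : ι → ℝ} (h0 : ∀ p, 0 ≤ x p) (h1 : ∀ p, x p < 1)
    (s : Finset ι) :
    Continuous fun θ : ι → UnitAddCircle => ∏ p ∈ s, poissonKernelAddCircle (x p) (θ p) :=
  continuous_finsetProd _ fun p _ =>
    (continuous_poissonKernelAddCircle (h0 p) (h1 p)).comp (continuous_apply p)

/-- The quadratic form with kernel `∏ x_p ^ |v_p - v'_p|` is the mean of a trigonometric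
polynomial against a product of Poisson kernels. -/
theorem sum_prod_pow_natAbs_eq_integral {ι κ : Type*} [Fintype ι] [Fintype κ]
    {x : ι → ℝ} (h0 : ∀ p, 0 ≤ x p) (h1 : ∀ p, x p < 1)
    (v : κ → ι → ℤ) :
    ∑ i, ∑ j, ∏ p, x p ^ (v i p - v j p).natAbs
      = ∫ θ, (∏ p, poissonKernelAddCircle (x p) (θ p)) * ‖trigSum v θ‖ ^ 2 ∂torusMeasure ι := by
  apply Complex.ofReal_injective
  rw [← integral_complex_ofReal]
  have key : ∀ θ : ι → UnitAddCircle,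
      (((∏ p, poissonKernelAddCircle (x p) (θ p)) * ‖trigSum v θ‖ ^ 2 : ℝ) : ℂ)
      = ∑ i, ∑ j, ∏ p, ((poissonKernelAddCircle (x p) (θ p) : ℂ)
          * fourier (v i p - v j p) (θ p)) := fun θ => by
    push_cast
    rw [← Complex.mul_conj']
    simp only [trigSum, map_sum, map_prod]
    rw [Finset.sum_mul_sum]
    simp only [Finset.mul_sum, sub_eq_add_neg, fourier_add, fourier_neg, Finset.prod_mul_distrib]
  simp_rw [key]
  have hc : ∀ i j, Continuous fun θ : ι → UnitAddCircle =>
      ∏ p, ((poissonKernelAddCircle (x p) (θ p) : ℂ) * fourier (v i p - v j p) (θ p)) :=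
    fun i j => continuous_finsetProd _ fun p _ =>
      ((Complex.continuous_ofReal.comp (continuous_poissonKernelAddCircle (h0 p) (h1 p))).mul
        (fourier (v i p - v j p)).continuous).comp (continuous_apply p)
  rw [integral_finsetSum _ fun i _ => integrable_finsetSum _ fun j _ =>
    (hc i j).integrable_of_compactSpace]
  push_cast
  refine Finset.sum_congr rfl fun i _ => ?_
  rw [integral_finsetSum _ fun j _ => (hc i j).integrable_of_compactSpace]
  refine Finset.sum_congr rfl fun j _ => ?_
  rw [integral_fintype_prod_eq_prod (fun p t =>
    (poissonKernelAddCircle (x p) t : ℂ) * fourier (v i p - v j p) t)]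
  exact Finset.prod_congr rfl fun p _ =>
    (integral_poissonKernel_mul_fourier (h0 p) (h1 p) _).symm

/-- Parseval, obtained as the case `x = 0` of the quadratic form: the kernel becomes 1 and `0 ^ |d|`
is the indicator of `d = 0`. -/
theorem integral_norm_trigSum_sq {ι κ : Type*} [Fintype ι] [Fintype κ]
    {v : κ → ι → ℤ} (hv : Function.Injective v) :
    ∫ θ, ‖trigSum v θ‖ ^ 2 ∂torusMeasure ι = Fintype.card κ := by
  classical
  have h := sum_prod_pow_natAbs_eq_integral (x := fun _ : ι => (0 : ℝ)) (fun _ => le_rfl)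
    (fun _ => one_pos) v
  simp only [poissonKernelAddCircle_zero, Finset.prod_const_one, one_mul] at h
  rw [← h]
  have : ∀ i j, ∏ p, (0 : ℝ) ^ (v i p - v j p).natAbs = if i = j then 1 else 0 := fun i j => by
    split_ifs with hij
    · simp [hij]
    · obtain ⟨p, hp⟩ := Function.ne_iff.1 (hv.ne hij)
      exact Finset.prod_eq_zero (Finset.mem_univ p) (zero_pow (by
        rw [Int.natAbs_ne_zero]; exact sub_ne_zero.2 hp))
  simp [this]

/-- Where `W` exceeds the level `a`, the ratio `(W / a)^q` is at least 1. This trades a pointwise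
bound for a high moment. -/
theorem le_add_pow_div {W a : ℝ} (hW : 0 ≤ W) (ha : 0 < a) (q : ℕ) :
    W ≤ a + W ^ (q + 1) / a ^ q := by
  rcases le_total W a with h | h
  · have : 0 ≤ W ^ (q + 1) / a ^ q := by positivity
    linarith
  · have : W ≤ W ^ (q + 1) / a ^ q := by
      rw [le_div_iff₀ (by positivity), pow_succ, mul_comm]
      exact mul_le_mul_of_nonneg_right (pow_le_pow_left₀ ha.le h q) hW
    linarith

/-- Coordinates in `s` are bounded by the maximum of their Poisson kernel. For the product `W` of
the others, the level `a` is paired with Parseval and the excess `W^(q+1) / a^q` with the trivial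
bound on `|D|²`; independence of the coordinates makes the moment a product. -/
theorem sum_prod_pow_natAbs_le {ι κ : Type*} [Fintype ι] [Fintype κ] [DecidableEq ι] {x : ι → ℝ} (h0 : ∀ p, 0 ≤ x p)
    (h1 : ∀ p, x p < 1) {v : κ → ι → ℤ} (hv : Function.Injective v) (s : Finset ι)
    (hs : ∀ p ∈ sᶜ, x p ≤ 1 / 5) {a : ℝ} (ha : 0 < a) (q : ℕ) :
    ∑ i, ∑ j, ∏ p, x p ^ (v i p - v j p).natAbs
      ≤ (∏ p ∈ s, (1 + x p) / (1 - x p)) * (a * Fintype.card κ + (Fintype.card κ : ℝ) ^ 2 / a ^ q *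
        Real.exp (12 * ((q : ℝ) + 1) ^ 2 * ∑ p ∈ sᶜ, x p ^ 2)) := by
  set W : (ι → UnitAddCircle) → ℝ := fun θ => ∏ p ∈ sᶜ, poissonKernelAddCircle (x p) (θ p) with hW
  set A : ℝ := ∏ p ∈ s, (1 + x p) / (1 - x p) with hA
  have hA0 : 0 ≤ A := Finset.prod_nonneg fun p _ =>
    div_nonneg (by linarith [h0 p]) (by linarith [h1 p])
  have hWc : Continuous W := continuous_prod_poissonKernel h0 h1 _
  have hW0 : ∀ θ, 0 ≤ W θ := fun θ =>
    Finset.prod_nonneg fun p _ => poissonKernelAddCircle_nonneg (h0 p) (h1 p) _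
  have hDc : Continuous fun θ => ‖trigSum v θ‖ ^ 2 := (continuous_trigSum v).norm.pow 2
  have hmoment : ∫ θ, W θ ^ (q + 1) ∂torusMeasure ι
      ≤ Real.exp (12 * ((q : ℝ) + 1) ^ 2 * ∑ p ∈ sᶜ, x p ^ 2) := by
    have e : ∀ θ, W θ ^ (q + 1)
        = ∏ p, (if p ∈ sᶜ then poissonKernelAddCircle (x p) (θ p) ^ (q + 1) else 1) := fun θ => by
      rw [hW, Finset.prod_ite_mem, Finset.univ_inter, Finset.prod_pow]
    simp_rw [e]
    rw [integral_fintype_prod_eq_prod (fun p (t : UnitAddCircle) =>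
      if p ∈ sᶜ then poissonKernelAddCircle (x p) t ^ (q + 1) else 1)]
    have e2 : ∀ p, ∫ t : UnitAddCircle, (if p ∈ sᶜ then poissonKernelAddCircle (x p) t ^ (q + 1)
        else 1) ∂haarAddCircle = if p ∈ sᶜ then
          ∫ t : UnitAddCircle, poissonKernelAddCircle (x p) t ^ (q + 1) ∂haarAddCircle else 1 :=
      fun p => by split_ifs <;> simp
    simp_rw [e2]
    rw [Finset.prod_ite_mem, Finset.univ_inter, Finset.mul_sum, Real.exp_sum]
    refine Finset.prod_le_prod (fun p _ => integral_nonneg fun t =>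
      pow_nonneg (poissonKernelAddCircle_nonneg (h0 p) (h1 p) t) _) fun p hp => ?_
    have := integral_poissonKernel_pow_le (h0 p) (hs p hp) (q := q + 1) (by omega)
    push_cast at this
    exact this
  rw [sum_prod_pow_natAbs_eq_integral h0 h1]
  calc ∫ θ, (∏ p, poissonKernelAddCircle (x p) (θ p)) * ‖trigSum v θ‖ ^ 2 ∂torusMeasure ι
      ≤ ∫ θ, A * (a * ‖trigSum v θ‖ ^ 2 + (Fintype.card κ : ℝ) ^ 2 / a ^ q * W θ ^ (q + 1))
          ∂torusMeasure ι := by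
        refine integral_mono ?_ ?_ fun θ => ?_
        · exact ((continuous_prod_poissonKernel h0 h1 _).mul hDc).integrable_of_compactSpace
        · exact (continuous_const.mul ((continuous_const.mul hDc).add
            (continuous_const.mul (hWc.pow _)))).integrable_of_compactSpace
        · dsimp only
          rw [← Finset.prod_mul_prod_compl s, mul_assoc]
          refine mul_le_mul ?_ ?_ (mul_nonneg (hW0 θ) (sq_nonneg _)) hA0
          · exact Finset.prod_le_prod
              (fun p _ => poissonKernelAddCircle_nonneg (h0 p) (h1 p) _)
              fun p _ => poissonKernelAddCircle_le (h0 p) (h1 p) _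
          · change W θ * _ ≤ _
            have hD : ‖trigSum v θ‖ ^ 2 ≤ (Fintype.card κ : ℝ) ^ 2 :=
              pow_le_pow_left₀ (norm_nonneg _) (norm_trigSum_le v θ) 2
            calc W θ * ‖trigSum v θ‖ ^ 2
                ≤ (a + W θ ^ (q + 1) / a ^ q) * ‖trigSum v θ‖ ^ 2 :=
                  mul_le_mul_of_nonneg_right (le_add_pow_div (hW0 θ) ha q) (sq_nonneg _)
              _ = a * ‖trigSum v θ‖ ^ 2 + W θ ^ (q + 1) / a ^ q * ‖trigSum v θ‖ ^ 2 := by ring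
              _ ≤ a * ‖trigSum v θ‖ ^ 2 + W θ ^ (q + 1) / a ^ q * (Fintype.card κ : ℝ) ^ 2 := by
                  have := hW0 θ
                  gcongr
              _ = _ := by ring
    _ = A * (a * Fintype.card κ + (Fintype.card κ : ℝ) ^ 2 / a ^ q *
          ∫ θ, W θ ^ (q + 1) ∂torusMeasure ι) := by
        have hi1 : Integrable (fun θ => a * ‖trigSum v θ‖ ^ 2) (torusMeasure ι) :=
          (continuous_const.mul hDc).integrable_of_compactSpace
        have hi2 : Integrable (fun θ => (Fintype.card κ : ℝ) ^ 2 / a ^ q * W θ ^ (q + 1))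
            (torusMeasure ι) := (continuous_const.mul (hWc.pow _)).integrable_of_compactSpace
        rw [integral_const_mul, integral_add hi1 hi2, integral_const_mul, integral_const_mul, integral_norm_trigSum_sq hv]
    _ ≤ _ := by gcongr

end Poisson

/-! ### Arithmetic form of the upper bound. -/

/-- Prime by prime, this is `2 min(e, f) - e - f = -|e - f|`. -/
theorem gcd_sq_div_mul_eq_prod {m n : ℕ} (hm : m ≠ 0) (hn : n ≠ 0) {P : Finset ℕ}
    (hmP : m.primeFactors ⊆ P) (hnP : n.primeFactors ⊆ P) :
    ((Nat.gcd m n : ℝ) ^ 2) / ((m : ℝ) * (n : ℝ))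
      = ∏ p ∈ P, ((p : ℝ)⁻¹) ^ ((m.factorization p : ℤ) - n.factorization p).natAbs := by
  have hfac : ∀ {a : ℕ}, a ≠ 0 → a.primeFactors ⊆ P →
      (a : ℝ) = ∏ p ∈ P, (p : ℝ) ^ a.factorization p := fun {a} ha haP => by
    conv_lhs => rw [← Nat.prod_factorization_pow_eq_self ha]
    rw [Finsupp.prod_of_support_subset _ (by simpa using haP) _ (by simp)]
    push_cast; rfl
  have hg : Nat.gcd m n ≠ 0 := Nat.gcd_ne_zero_left hm
  have hgP : (Nat.gcd m n).primeFactors ⊆ P :=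
    (Nat.primeFactors_mono (Nat.gcd_dvd_left m n) hm).trans hmP
  rw [hfac hm hmP, hfac hn hnP, hfac hg hgP, ← Finset.prod_pow, ← Finset.prod_mul_distrib,
    ← Finset.prod_div_distrib]
  refine Finset.prod_congr rfl fun p _ => ?_
  rw [Nat.factorization_gcd hm hn]
  simp only [Finsupp.inf_apply]
  rcases Nat.eq_zero_or_pos p with rfl | hp
  · simp
  have hp' : (p : ℝ) ≠ 0 := by exact_mod_cast hp.ne'
  rcases le_total (m.factorization p) (n.factorization p) with h | h
  · obtain ⟨d, hd⟩ := Nat.exists_eq_add_of_le h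
    rw [hd, min_eq_left (by omega)]
    have : ((m.factorization p : ℤ) - (m.factorization p + d : ℕ)).natAbs = d := by omega
    rw [this, pow_add, inv_pow]
    field_simp
  · obtain ⟨d, hd⟩ := Nat.exists_eq_add_of_le h
    rw [hd, min_eq_right (by omega)]
    have : (((n.factorization p + d : ℕ) : ℤ) - (n.factorization p : ℤ)).natAbs = d := by omega
    rw [this, pow_add, inv_pow]
    field_simp

/-- The product `∏_{p ≤ N} (1 + 1/p) / (1 - 1/p)`. -/
noncomputable def poissonEulerProduct (N : ℕ) : ℝ :=
  ∏ p ∈ Nat.primesLE N, (1 + (p : ℝ)⁻¹) / (1 - (p : ℝ)⁻¹)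

theorem one_le_one_add_inv_div {p : ℕ} (hp : p.Prime) :
    1 ≤ (1 + (p : ℝ)⁻¹) / (1 - (p : ℝ)⁻¹) := by
  have h : (1 : ℝ) < p := by exact_mod_cast hp.one_lt
  have h2 : (p : ℝ)⁻¹ < 1 := inv_lt_one_of_one_lt₀ h
  have h3 : 0 < (p : ℝ)⁻¹ := by positivity
  rw [le_div_iff₀ (by linarith)]; linarith

theorem poissonEulerProduct_pos (N : ℕ) : 0 < poissonEulerProduct N :=
  Finset.prod_pos fun _ hp =>
    lt_of_lt_of_le one_pos (one_le_one_add_inv_div (Nat.prime_of_mem_primesLE hp))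

theorem sum_inv_sq_le_of_lt {y : ℕ} (hy : y ≠ 0) {B : Finset ℕ} (hB : ∀ n ∈ B, y < n) :
    ∑ n ∈ B, ((n : ℝ)⁻¹) ^ 2 ≤ (y : ℝ)⁻¹ := by
  have hsub : B ⊆ Finset.Ioc y (max y (B.sup id)) := fun n hn => by
    rw [Finset.mem_Ioc]
    exact ⟨hB n hn, le_max_of_le_right (Finset.le_sup (f := id) hn)⟩
  calc ∑ n ∈ B, ((n : ℝ)⁻¹) ^ 2 ≤ ∑ n ∈ Finset.Ioc y (max y (B.sup id)), ((n : ℝ)⁻¹) ^ 2 :=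
        Finset.sum_le_sum_of_subset_of_nonneg hsub fun _ _ _ => by positivity
    _ = ∑ n ∈ Finset.Ioc y (max y (B.sup id)), ((n : ℝ) ^ 2)⁻¹ := by simp_rw [inv_pow]
    _ ≤ (y : ℝ)⁻¹ - ((max y (B.sup id) : ℕ) : ℝ)⁻¹ := sum_Ioc_inv_sq_le_sub hy (le_max_left _ _)
    _ ≤ _ := sub_le_self _ (by positivity)

/-- Applies the torus estimate with one coordinate per prime dividing some `n i`, split at `y`.
Unique factorization makes the frequencies distinct, and the tail of `1/p²` beyond `y` is at most
`1/y`. -/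
theorem gcdSum_le {k : ℕ} {n : Fin k → ℕ} (hn : Function.Injective n) (hpos : ∀ i, n i ≠ 0)
    {y : ℕ} (hy : 4 ≤ y) {a : ℝ} (ha : 0 < a) (q : ℕ) :
    gcdSum n ≤ poissonEulerProduct y *
      (a * k + (k : ℝ) ^ 2 / a ^ q * Real.exp (12 * ((q : ℝ) + 1) ^ 2 / y)) := by
  classical
  set P : Finset ℕ := Finset.univ.biUnion fun i => (n i).primeFactors with hP
  have hsub : ∀ i, (n i).primeFactors ⊆ P := fun i =>
    Finset.subset_biUnion_of_mem (fun i => (n i).primeFactors) (Finset.mem_univ i)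
  have hprime : ∀ p ∈ P, p.Prime := fun p hp => by
    obtain ⟨i, -, hi⟩ := Finset.mem_biUnion.1 hp
    exact Nat.prime_of_mem_primeFactors hi
  set v : Fin k → P → ℤ := fun i p => (n i).factorization p with hv
  have hvinj : Function.Injective v := fun i j hij => by
    refine hn (Nat.eq_of_factorization_eq (hpos i) (hpos j) fun p => ?_)
    by_cases hp : p ∈ P
    · have := congrFun hij ⟨p, hp⟩
      simpa [hv] using this
    · rw [Finsupp.notMem_support_iff.1 fun h => hp (hsub i h),
        Finsupp.notMem_support_iff.1 fun h => hp (hsub j h)]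
  have hone : ∀ p : P, (1 : ℝ) < p := fun p => by exact_mod_cast (hprime p p.2).one_lt
  set s : Finset P := Finset.univ.filter fun p => (p : ℕ) ≤ y with hs
  have hmem : ∀ p ∈ sᶜ, y < (p : ℕ) := fun p hp => by simpa [hs] using hp
  have key := sum_prod_pow_natAbs_le (x := fun p : P => ((p : ℕ) : ℝ)⁻¹)
    (fun p => by positivity) (fun p => inv_lt_one_of_one_lt₀ (hone p)) hvinj s
    (fun p hp => by
      -- This is where `4 ≤ y` is needed: the moment bound requires radius at most `1/5`.
      have h5 : (5 : ℝ) ≤ (p : ℕ) := by exact_mod_cast (by have := hmem p hp; omega)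
      rw [one_div]
      exact inv_anti₀ (by norm_num) h5) ha q
  have e1 : gcdSum n = ∑ i, ∑ j, ∏ p : P, (((p : ℕ) : ℝ)⁻¹) ^ (v i p - v j p).natAbs := by
    unfold gcdSum
    refine Finset.sum_congr rfl fun i _ => Finset.sum_congr rfl fun j _ => ?_
    rw [gcd_sq_div_mul_eq_prod (hpos i) (hpos j) (hsub i) (hsub j), ← Finset.prod_coe_sort]
  have e2 : ∏ p ∈ s, (1 + ((p : ℕ) : ℝ)⁻¹) / (1 - ((p : ℕ) : ℝ)⁻¹) ≤ poissonEulerProduct y := by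
    rw [← Finset.prod_image (s := s) (g := fun p : P => (p : ℕ))
      (f := fun p : ℕ => (1 + (p : ℝ)⁻¹) / (1 - (p : ℝ)⁻¹)) (Subtype.val_injective.injOn)]
    have hsy : s.image (fun p : P => (p : ℕ)) ⊆ Nat.primesLE y := fun p hp => by
      obtain ⟨p', hp', rfl⟩ := Finset.mem_image.1 hp
      rw [Nat.mem_primesLE]
      exact ⟨by simpa [hs] using hp', hprime p' p'.2⟩
    unfold poissonEulerProduct
    -- Primes up to `y` that divide no `n i` contribute factors at least 1, so including them is
    -- harmless.
    rw [← Finset.prod_sdiff hsy]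
    refine le_mul_of_one_le_left (Finset.prod_nonneg fun p hp => zero_le_one.trans
      (one_le_one_add_inv_div (Nat.prime_of_mem_primesLE (hsy hp)))) ?_
    exact Finset.one_le_prod fun p hp =>
      one_le_one_add_inv_div (Nat.prime_of_mem_primesLE (Finset.mem_sdiff.1 hp).1)
  have e3 : ∑ p ∈ sᶜ, (((p : ℕ) : ℝ)⁻¹) ^ 2 ≤ (y : ℝ)⁻¹ := by
    rw [← Finset.sum_image (s := sᶜ) (g := fun p : P => (p : ℕ))
      (f := fun p : ℕ => ((p : ℝ)⁻¹) ^ 2) (Subtype.val_injective.injOn)]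
    refine sum_inv_sq_le_of_lt (by omega) fun p hp => ?_
    obtain ⟨p', hp', rfl⟩ := Finset.mem_image.1 hp
    exact hmem p' hp'
  rw [e1]
  refine key.trans ?_
  rw [Fintype.card_fin, div_eq_mul_inv (12 * ((q : ℝ) + 1) ^ 2)]
  have := (poissonEulerProduct_pos y).le
  gcongr

/-! ### Extremal construction: grids of prime powers and Toeplitz sums. -/

/-- The kernel `(a, b)² / (a b)` of GCD sums. -/
noncomputable def gcdKernel (a b : ℕ) : ℝ := ((Nat.gcd a b : ℝ) ^ 2) / ((a : ℝ) * (b : ℝ))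

/-- The GCD sum over a finite set of integers. -/
noncomputable def gcdForm (A : Finset ℕ) : ℝ := ∑ a ∈ A, ∑ b ∈ A, gcdKernel a b

/-- The sum of the entries of the Toeplitz matrix `x ^ |e - f|` indexed by `E`. -/
noncomputable def toeplitzSum (x : ℝ) (E : Finset ℕ) : ℝ :=
  ∑ e ∈ E, ∑ f ∈ E, x ^ ((e : ℤ) - f).natAbs

theorem gcdKernel_nonneg (a b : ℕ) : 0 ≤ gcdKernel a b := by unfold gcdKernel; positivity

theorem gcdForm_nonneg (A : Finset ℕ) : 0 ≤ gcdForm A :=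
  Finset.sum_nonneg fun _ _ => Finset.sum_nonneg fun _ _ => gcdKernel_nonneg _ _

theorem gcdForm_mono {A B : Finset ℕ} (h : A ⊆ B) : gcdForm A ≤ gcdForm B :=
  (Finset.sum_le_sum fun a _ => Finset.sum_le_sum_of_subset_of_nonneg h
    fun b _ _ => gcdKernel_nonneg a b).trans
  (Finset.sum_le_sum_of_subset_of_nonneg h fun _ _ _ =>
    Finset.sum_nonneg fun _ _ => gcdKernel_nonneg _ _)

theorem gcdKernel_comm (a b : ℕ) : gcdKernel a b = gcdKernel b a := by
  unfold gcdKernel; rw [Nat.gcd_comm, mul_comm]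

/-- The surplus `p ^ d` is coprime to `a`, so it enlarges the denominator without enlarging the gcd.
-/
theorem gcdKernel_mul_pow_of_le {a b p : ℕ} (hp : p.Prime) (ha : ¬ p ∣ a) (e d : ℕ) :
    gcdKernel (a * p ^ e) (b * p ^ (e + d)) = gcdKernel a b * ((p : ℝ)⁻¹) ^ d := by
  have h : Nat.gcd (a * p ^ e) (b * p ^ (e + d)) = Nat.gcd a b * p ^ e := by
    rw [show b * p ^ (e + d) = (b * p ^ d) * p ^ e by ring, Nat.gcd_mul_right]
    congr 1
    exact Nat.Coprime.gcd_mul_right_cancel_right b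
      (Nat.Coprime.pow_left d ((Nat.Prime.coprime_iff_not_dvd hp).2 ha))
  have hp' : (p : ℝ) ≠ 0 := by exact_mod_cast hp.ne_zero
  unfold gcdKernel
  rw [h]
  push_cast
  rw [pow_add, inv_pow]
  rcases Nat.eq_zero_or_pos a with rfl | ha0
  · simp
  rcases Nat.eq_zero_or_pos b with rfl | hb0
  · simp
  have ha' : (a : ℝ) ≠ 0 := by exact_mod_cast ha0.ne'
  have hb' : (b : ℝ) ≠ 0 := by exact_mod_cast hb0.ne'
  field_simp

theorem gcdKernel_mul_pow {a b p : ℕ} (hp : p.Prime) (ha : ¬ p ∣ a) (hb : ¬ p ∣ b) (e f : ℕ) :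
    gcdKernel (a * p ^ e) (b * p ^ f)
      = gcdKernel a b * ((p : ℝ)⁻¹) ^ ((e : ℤ) - f).natAbs := by
  rcases le_total e f with h | h
  · obtain ⟨d, rfl⟩ := Nat.exists_eq_add_of_le h
    rw [gcdKernel_mul_pow_of_le hp ha]
    congr 2; omega
  · obtain ⟨d, rfl⟩ := Nat.exists_eq_add_of_le h
    rw [gcdKernel_comm, gcdKernel_mul_pow_of_le hp hb, gcdKernel_comm]
    congr 2; omega

/-- All products of an element of `S` and a power of `p` with exponent in `E`. -/
def mulPowers (S : Finset ℕ) (p : ℕ) (E : Finset ℕ) : Finset ℕ :=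
  (S ×ˢ E).image fun x => x.1 * p ^ x.2

theorem mulPowers_injOn {S : Finset ℕ} {p : ℕ} (hp : p.Prime) (hS : ∀ a ∈ S, ¬ p ∣ a)
    (E : Finset ℕ) : Set.InjOn (fun x : ℕ × ℕ => x.1 * p ^ x.2) (S ×ˢ E : Finset (ℕ × ℕ)) := by
  rintro ⟨a, e⟩ ha ⟨b, f⟩ hb hab
  simp only [Finset.coe_product, Set.mem_prod, Finset.mem_coe] at ha hb hab
  have hfac : ∀ {c g : ℕ}, ¬ p ∣ c → (c * p ^ g).factorization p = g := fun {c g} hc => by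
    have hc0 : c ≠ 0 := fun h => hc (h ▸ dvd_zero p)
    rw [Nat.factorization_mul hc0 (pow_ne_zero _ hp.ne_zero)]
    simp [hp.factorization_self, Nat.factorization_eq_zero_of_not_dvd hc]
  have he : e = f := by rw [← hfac (hS a ha.1) (g := e), hab, hfac (hS b hb.1)]
  subst he
  rw [Nat.eq_of_mul_eq_mul_right (pow_pos hp.pos e) hab]

theorem card_mulPowers {S : Finset ℕ} {p : ℕ} (hp : p.Prime) (hS : ∀ a ∈ S, ¬ p ∣ a)
    (E : Finset ℕ) : (mulPowers S p E).card = S.card * E.card := by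
  unfold mulPowers
  rw [Finset.card_image_of_injOn (mulPowers_injOn hp hS E), Finset.card_product]

theorem gcdForm_mulPowers {S : Finset ℕ} {p : ℕ} (hp : p.Prime) (hS : ∀ a ∈ S, ¬ p ∣ a)
    (E : Finset ℕ) : gcdForm (mulPowers S p E) = gcdForm S * toeplitzSum (p : ℝ)⁻¹ E := by
  unfold gcdForm mulPowers toeplitzSum
  rw [Finset.sum_image (mulPowers_injOn hp hS E), Finset.sum_product, Finset.sum_mul]
  refine Finset.sum_congr rfl fun a ha => ?_
  rw [Finset.mul_sum]
  refine Finset.sum_congr rfl fun e _ => ?_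
  rw [Finset.sum_image (mulPowers_injOn hp hS E), Finset.sum_product, Finset.sum_mul]
  refine Finset.sum_congr rfl fun b hb => ?_
  rw [Finset.mul_sum]
  exact Finset.sum_congr rfl fun f _ => gcdKernel_mul_pow hp (hS a ha) (hS b hb) e f

/-- `S` is the grid of products of powers `p ^ e`, `e < M`, built one prime at a time. Recording
that all prime factors lie in `Q` lets the induction adjoin a new prime, and later allows one more
prime outside the grid. -/
theorem exists_gcdForm_eq_prod (Q : Finset ℕ) (hQ : ∀ p ∈ Q, p.Prime) (M : ℕ) :
    ∃ S : Finset ℕ, (∀ a ∈ S, a ≠ 0 ∧ ∀ p, p.Prime → p ∣ a → p ∈ Q) ∧ S.card = M ^ Q.card ∧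
      gcdForm S = ∏ p ∈ Q, toeplitzSum (p : ℝ)⁻¹ (Finset.range M) := by
  classical
  induction Q using Finset.induction_on with
  | empty =>
    refine ⟨{1}, fun a ha => ?_, by simp, by simp [gcdForm, gcdKernel]⟩
    rw [Finset.mem_singleton] at ha
    subst ha
    exact ⟨one_ne_zero, fun p hp h => absurd h hp.not_dvd_one⟩
  | insert p Q hpQ ih =>
    obtain ⟨S, hS, hcard, hform⟩ := ih fun q hq => hQ q (Finset.mem_insert_of_mem hq)
    have hp := hQ p (Finset.mem_insert_self p Q)
    have hpS : ∀ a ∈ S, ¬ p ∣ a := fun a ha h => hpQ ((hS a ha).2 p hp h)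
    refine ⟨mulPowers S p (Finset.range M), fun a ha => ?_, ?_, ?_⟩
    · obtain ⟨⟨b, e⟩, hb, rfl⟩ := Finset.mem_image.1 ha
      rw [Finset.mem_product] at hb
      refine ⟨mul_ne_zero (hS b hb.1).1 (pow_ne_zero _ hp.ne_zero), fun q hq h => ?_⟩
      rcases (Nat.Prime.dvd_mul hq).1 h with h | h
      · exact Finset.mem_insert_of_mem ((hS b hb.1).2 q hq h)
      · rw [(Nat.prime_dvd_prime_iff_eq hq hp).1 (hq.dvd_of_dvd_pow h)]
        exact Finset.mem_insert_self p Q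
    · rw [card_mulPowers hp hpS, hcard, Finset.card_insert_of_notMem hpQ, Finset.card_range,
        pow_succ]
    · rw [gcdForm_mulPowers hp hpS, hform, Finset.prod_insert hpQ, mul_comm]

/-- Passing from `M` to `M + 1` adds a row and a column, both geometric sums, and a diagonal entry
1. -/
theorem toeplitzSum_range {x : ℝ} (hx : x ≠ 1) (M : ℕ) :
    toeplitzSum x (Finset.range M)
      = M * ((1 + x) / (1 - x)) - 2 * x * (1 - x ^ M) / (1 - x) ^ 2 := by
  have h1 : 1 - x ≠ 0 := sub_ne_zero.2 hx.symm
  induction M with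
  | zero => simp [toeplitzSum]
  | succ M ih =>
    have hrow : ∑ f ∈ Finset.range M, x ^ ((M : ℤ) - f).natAbs = x * (1 - x ^ M) / (1 - x) := by
      rw [← Finset.sum_range_reflect]
      have : ∀ j ∈ Finset.range M, x ^ ((M : ℤ) - ((M - 1 - j : ℕ) : ℤ)).natAbs = x * x ^ j :=
        fun j hj => by
          rw [Finset.mem_range] at hj
          rw [← pow_succ']
          congr 1; omega
      rw [Finset.sum_congr rfl this, ← Finset.mul_sum, geom_sum_eq hx, mul_div_assoc,
        ← neg_div_neg_eq, neg_sub, neg_sub]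
    have hcol : ∑ e ∈ Finset.range M, x ^ ((e : ℤ) - M).natAbs = x * (1 - x ^ M) / (1 - x) := by
      rw [← hrow]
      refine Finset.sum_congr rfl fun e _ => ?_
      congr 1; omega
    have : toeplitzSum x (Finset.range (M + 1)) = toeplitzSum x (Finset.range M)
        + 2 * (x * (1 - x ^ M) / (1 - x)) + 1 := by
      unfold toeplitzSum
      simp_rw [Finset.sum_range_succ]
      rw [Finset.sum_add_distrib, hrow, hcol]
      simp
      ring
    rw [this, ih]
    push_cast
    field_simp
    ring

/-- The boundary correction is at most twice the main density, since `x ≤ 1 - x²` for `x ≤ 1/2`; the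
relative loss is therefore `2/M` for every prime. -/
theorem le_toeplitzSum_range {x : ℝ} (h0 : 0 ≤ x) (h1 : x ≤ 1 / 2) (M : ℕ) :
    ((M : ℝ) - 2) * ((1 + x) / (1 - x)) ≤ toeplitzSum x (Finset.range M) := by
  have hx : 0 < 1 - x := by linarith
  rw [toeplitzSum_range (by linarith)]
  have h2 : 2 * x * (1 - x ^ M) / (1 - x) ^ 2 ≤ 2 * ((1 + x) / (1 - x)) := by
    rw [div_le_iff₀ (by positivity)]
    have e : 2 * ((1 + x) / (1 - x)) * (1 - x) ^ 2 = 2 * ((1 + x) * (1 - x)) := by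
      field_simp
    rw [e]
    have := mul_nonneg h0 (pow_nonneg h0 M)
    nlinarith
  linarith

theorem card_le_toeplitzSum {x : ℝ} (h0 : 0 ≤ x) (E : Finset ℕ) : (E.card : ℝ) ≤ toeplitzSum x E := by
  unfold toeplitzSum
  rw [Finset.card_eq_sum_ones, Nat.cast_sum]
  refine Finset.sum_le_sum fun e he => ?_
  refine le_trans ?_ (Finset.single_le_sum (fun f _ => pow_nonneg h0 _) he)
  simp

theorem exists_strictMono_gcdSum_eq (A : Finset ℕ) (hA : ∀ a ∈ A, 1 < a) {k : ℕ}
    (hk : A.card = k) :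
    ∃ n : Fin k → ℕ, StrictMono n ∧ (∀ i, 1 < n i) ∧ gcdSum n = gcdForm A := by
  refine ⟨A.orderEmbOfFin hk, (A.orderEmbOfFin hk).strictMono,
    fun i => hA _ (A.orderEmbOfFin_mem hk i), ?_⟩
  have h : ∀ g : ℕ → ℝ, ∑ i, g (A.orderEmbOfFin hk i) = ∑ a ∈ A, g a := fun g => by
    conv_rhs => rw [← Finset.image_orderEmbOfFin_univ A hk]
    rw [Finset.sum_image (A.orderEmbOfFin hk).injective.injOn]
  unfold gcdSum gcdForm gcdKernel
  rw [← h]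
  exact Finset.sum_congr rfl fun i _ =>
    h fun b => ((Nat.gcd (A.orderEmbOfFin hk i) b : ℝ) ^ 2) / ((A.orderEmbOfFin hk i : ℝ) * b)

/-- Take `T = k / s` copies of the grid of size `s`, multiplied by powers of a prime `P > y`, and
pad to exactly `k` elements. Each copy contributes the full form of the grid; cross terms between
copies are discarded. -/
theorem exists_strictMono_le_gcdSum (k y : ℕ) {M : ℕ} (hM : 1 ≤ M) :
    ∃ n : Fin k → ℕ, StrictMono n ∧ (∀ i, 1 < n i) ∧
      ((k / M ^ (Nat.primesLE y).card : ℕ) : ℝ) *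
        ∏ p ∈ Nat.primesLE y, toeplitzSum (p : ℝ)⁻¹ (Finset.range M) ≤ gcdSum n := by
  obtain ⟨S, hS, hcard, hform⟩ :=
    exists_gcdForm_eq_prod (Nat.primesLE y) (fun p hp => Nat.prime_of_mem_primesLE hp) M
  obtain ⟨P, hPy, hP⟩ := Nat.exists_infinite_primes (y + 1)
  have hPS : ∀ a ∈ S, ¬ P ∣ a := fun a ha h => by
    have := Nat.le_of_mem_primesLE ((hS a ha).2 P hP h)
    omega
  set s := M ^ (Nat.primesLE y).card with hs
  have hspos : 0 < s := pow_pos hM _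
  set T := k / s with hT
  -- These sets have `s T ≤ k` and `s (T + 1) > k` elements, so a set of size `k` fits between them.
  -- Exponents start at 1 to keep every element greater than 1.
  have hsub : mulPowers S P (Finset.Icc 1 T) ⊆ mulPowers S P (Finset.Icc 1 (T + 1)) :=
    Finset.image_subset_image (Finset.product_subset_product_right
      (Finset.Icc_subset_Icc_right (Nat.le_succ T)))
  obtain ⟨A, hA1, hA2, hAk⟩ := Finset.exists_subsuperset_card_eq (n := k) hsub
    (by rw [card_mulPowers hP hPS, hcard, Nat.card_Icc, Nat.add_sub_cancel]
        exact Nat.mul_div_le k s)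
    (by rw [card_mulPowers hP hPS, hcard, Nat.card_Icc, Nat.add_sub_cancel]
        exact (Nat.lt_mul_div_succ k hspos).le)
  obtain ⟨n, hn1, hn2, hn3⟩ := exists_strictMono_gcdSum_eq A (fun a ha => by
    obtain ⟨⟨b, e⟩, hb, rfl⟩ := Finset.mem_image.1 (hA2 ha)
    rw [Finset.mem_product, Finset.mem_Icc] at hb
    have h1 : 1 < P ^ e := Nat.one_lt_pow (by have := hb.2.1; simp at this; omega) hP.one_lt
    exact lt_of_lt_of_le h1 (Nat.le_mul_of_pos_left _ (Nat.pos_of_ne_zero (hS b hb.1).1))) hAk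
  refine ⟨n, hn1, hn2, ?_⟩
  rw [hn3, ← hform]
  refine le_trans ?_ (gcdForm_mono hA1)
  rw [gcdForm_mulPowers hP hPS, mul_comm]
  refine mul_le_mul_of_nonneg_left ?_ (gcdForm_nonneg S)
  have := card_le_toeplitzSum (x := (P : ℝ)⁻¹) (by positivity) (Finset.Icc 1 T)
  simpa using this

theorem one_sub_mul_le_pow_of_le {c : ℝ} (hc : c ≤ 1) {m n : ℕ} (hmn : m ≤ n) (hc0 : 0 ≤ c) :
    1 - n * c ≤ (1 - c) ^ m := by
  have h := one_add_mul_le_pow (a := -c) (by linarith) n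
  have h2 : (1 - c) ^ n ≤ (1 - c) ^ m :=
    pow_le_pow_of_le_one (by linarith) (by linarith) hmn
  rw [← sub_eq_add_neg] at h
  linarith

theorem mul_poissonEulerProduct_le_prod_toeplitzSum {y M : ℕ} (hM : 2 ≤ M) :
    (M : ℝ) ^ (Nat.primesLE y).card * ((1 - y * (2 / M)) * poissonEulerProduct y)
      ≤ ∏ p ∈ Nat.primesLE y, toeplitzSum (p : ℝ)⁻¹ (Finset.range M) := by
  have hM' : (2 : ℝ) ≤ M := by exact_mod_cast hM
  have hcard : (Nat.primesLE y).card ≤ y := by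
    rw [Nat.primesLE_eq_filter_Ioc_zero]
    exact (Finset.card_filter_le _ _).trans (by simp)
  have h2M : 2 / (M : ℝ) ≤ 1 := by rw [div_le_one (by linarith)]; exact hM'
  calc _ ≤ (M : ℝ) ^ (Nat.primesLE y).card *
        ((1 - 2 / M) ^ (Nat.primesLE y).card * poissonEulerProduct y) := by
        refine mul_le_mul_of_nonneg_left ?_ (by positivity)
        exact mul_le_mul_of_nonneg_right (one_sub_mul_le_pow_of_le h2M hcard (by positivity))
          (poissonEulerProduct_pos y).le
    _ = ∏ p ∈ Nat.primesLE y, ((M : ℝ) - 2) * ((1 + (p : ℝ)⁻¹) / (1 - (p : ℝ)⁻¹)) := by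
        rw [← mul_assoc, ← mul_pow, Finset.prod_mul_distrib, Finset.prod_const]
        unfold poissonEulerProduct
        congr 2
        field_simp
    _ ≤ _ := by
        refine Finset.prod_le_prod (fun p hp => mul_nonneg (by linarith) (zero_le_one.trans
          (one_le_one_add_inv_div (Nat.prime_of_mem_primesLE hp)))) fun p hp => ?_
        refine le_toeplitzSum_range (by positivity) ?_ M
        have h2 : (2 : ℝ) ≤ p := by exact_mod_cast Nat.two_le_of_mem_primesLE hp
        rw [one_div]
        exact inv_anti₀ (by norm_num) h2

/-! ### Mertens' first theorem and convergence in the second. -/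

section Mertens

open ArithmeticFunction Filter Topology

theorem sum_log_eq_sum_vonMangoldt_mul (N : ℕ) :
    ∑ n ∈ Finset.Ioc 0 N, Real.log n = ∑ d ∈ Finset.Ioc 0 N, vonMangoldt d * ((N / d : ℕ) : ℝ) := by
  have h : ∀ n ∈ Finset.Ioc 0 N, Real.log n
      = ∑ d ∈ Finset.Ioc 0 N, if d ∣ n then vonMangoldt d else 0 := fun n hn => by
    rw [Finset.mem_Ioc] at hn
    rw [← vonMangoldt_sum, ← Finset.sum_filter]
    refine Finset.sum_congr ?_ fun _ _ => rfl
    ext d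
    simp only [Nat.mem_divisors, Finset.mem_filter, Finset.mem_Ioc]
    constructor
    · rintro ⟨h1, h2⟩
      exact ⟨⟨Nat.pos_of_dvd_of_pos h1 hn.1, (Nat.le_of_dvd hn.1 h1).trans hn.2⟩, h1⟩
    · rintro ⟨h1, h2⟩
      exact ⟨h2, by omega⟩
  rw [Finset.sum_congr rfl h, Finset.sum_comm]
  refine Finset.sum_congr rfl fun d _ => ?_
  rw [← Finset.sum_filter, Finset.sum_const, Nat.Ioc_filter_dvd_card_eq_div, nsmul_eq_mul, mul_comm]

theorem sum_log_eq_log_factorial (N : ℕ) :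
    ∑ n ∈ Finset.Ioc 0 N, Real.log n = Real.log (N.factorial) := by
  induction N with
  | zero => simp
  | succ N ih =>
    rw [← Finset.insert_Ioc_right_eq_Ioc_add_one (Nat.zero_le N), Finset.sum_insert (by simp), ih,
      Nat.factorial_succ]
    push_cast
    rw [Real.log_mul (by positivity) (by positivity)]

theorem mul_log_sub_le_log_factorial (N : ℕ) :
    (N : ℝ) * Real.log N - N ≤ Real.log (N.factorial) := by
  have h : (N : ℝ) ^ N / N.factorial ≤ Real.exp N := Real.pow_div_factorial_le_exp _ (by positivity) N
  rcases Nat.eq_zero_or_pos N with rfl | hN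
  · simp
  have hN' : (0 : ℝ) < N := by exact_mod_cast hN
  have h2 := Real.log_le_log (by positivity) h
  rw [Real.log_exp, Real.log_div (by positivity) (by positivity), Real.log_pow] at h2
  linarith

/-- Mertens' first theorem for the von Mangoldt function. -/
theorem abs_sum_vonMangoldt_div_sub_log_le {N : ℕ} (hN : 1 ≤ N) :
    |∑ n ∈ Finset.Ioc 0 N, vonMangoldt n / n - Real.log N| ≤ Real.log 4 + 4 := by
  have hN' : (0 : ℝ) < N := by exact_mod_cast hN
  have key := (sum_log_eq_log_factorial N).symm.trans (sum_log_eq_sum_vonMangoldt_mul N)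
  have hup : Real.log (N.factorial) ≤ N * ∑ n ∈ Finset.Ioc 0 N, vonMangoldt n / n := by
    rw [key, Finset.mul_sum]
    refine Finset.sum_le_sum fun d _ => ?_
    calc vonMangoldt d * ((N / d : ℕ) : ℝ) ≤ vonMangoldt d * ((N : ℝ) / d) :=
          mul_le_mul_of_nonneg_left Nat.cast_div_le vonMangoldt_nonneg
      _ = _ := by ring
  -- Each floor loses at most 1, at total cost `ψ(N)`, which Chebyshev's bound makes `O(N)`.
  have hlow : N * ∑ n ∈ Finset.Ioc 0 N, vonMangoldt n / n
      ≤ Real.log (N.factorial) + Chebyshev.psi N := by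
    rw [key, Finset.mul_sum, Chebyshev.psi, Nat.floor_natCast, ← Finset.sum_add_distrib]
    refine Finset.sum_le_sum fun d _ => ?_
    have h1 : (N : ℝ) / d ≤ ((N / d : ℕ) : ℝ) + 1 := by
      rw [← Nat.floor_div_eq_div (K := ℝ)]
      exact (Nat.lt_floor_add_one _).le
    calc (N : ℝ) * (vonMangoldt d / d) = vonMangoldt d * ((N : ℝ) / d) := by ring
      _ ≤ vonMangoldt d * (((N / d : ℕ) : ℝ) + 1) :=
          mul_le_mul_of_nonneg_left h1 vonMangoldt_nonneg
      _ = _ := by ring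
  have hpsi := Chebyshev.psi_le_const_mul_self hN'.le
  have hfac1 := mul_log_sub_le_log_factorial N
  have hfac2 : Real.log (N.factorial) ≤ N * Real.log N := by
    rw [← Real.log_pow]
    exact Real.log_le_log (by positivity) (by exact_mod_cast Nat.factorial_le_pow N)
  have hlog4 : 0 ≤ Real.log 4 := Real.log_nonneg (by norm_num)
  rw [abs_le]
  constructor
  · have : (N : ℝ) * (Real.log N - 1) ≤ N * ∑ n ∈ Finset.Ioc 0 N, vonMangoldt n / n := by linarith
    have := le_of_mul_le_mul_left this hN'
    linarith
  · have : (N : ℝ) * ∑ n ∈ Finset.Ioc 0 N, vonMangoldt n / n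
        ≤ N * (Real.log N + (Real.log 4 + 4)) := by linarith
    have := le_of_mul_le_mul_left this hN'
    linarith

/-- The partial sums of `Λ(n) / (n log n)`. -/
noncomputable def vonMangoldtLogSum (N : ℕ) : ℝ :=
  ∑ n ∈ Finset.Ioc 0 N, vonMangoldt n / (n * Real.log n)

theorem abs_log_sub_log_div_sub_le {u v : ℝ} (hu : 0 < u) (huv : u ≤ v) :
    |(v - u) / v - (Real.log v - Real.log u)| ≤ (v - u) ^ 2 / u ^ 2 := by
  have hv : 0 < v := hu.trans_le huv
  have h1 : Real.log v - Real.log u ≤ (v - u) / u := by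
    rw [← Real.log_div hv.ne' hu.ne']
    refine (Real.log_le_sub_one_of_pos (by positivity)).trans (le_of_eq ?_)
    field_simp
  have h2 : (v - u) / v ≤ Real.log v - Real.log u := by
    have := Real.log_le_sub_one_of_pos (show 0 < u / v by positivity)
    rw [Real.log_div hu.ne' hv.ne'] at this
    have e : (v - u) / v = 1 - u / v := by field_simp
    linarith
  have h3 : (v - u) / u - (v - u) / v ≤ (v - u) ^ 2 / u ^ 2 := by
    have e : (v - u) / u - (v - u) / v = (v - u) ^ 2 / (u * v) := by field_simp
    rw [e]
    exact div_le_div_of_nonneg_left (sq_nonneg _) (by positivity) (by nlinarith)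
  rw [abs_le]; constructor <;> linarith

theorem log_add_one_sub_log_le {x : ℝ} (hx : 0 < x) : Real.log (x + 1) - Real.log x ≤ 1 / x := by
  rw [← Real.log_div (by positivity) hx.ne']
  refine (Real.log_le_sub_one_of_pos (by positivity)).trans (le_of_eq ?_)
  field_simp
  ring

/-- Compare `Λ(n)/n` with `log n - log (n-1)`: the differences have bounded partial sums by Mertens'
first theorem, so weighting them by the decreasing `1/log n` gives a convergent series (Dirichlet's
test). Replacing the weighted increments of `log` by increments of `log log` costs a summable error.
-/
theorem tendsto_vonMangoldtLogSum_sub_log_log_of_dirichlet :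
    ∃ c, Tendsto (fun N : ℕ => vonMangoldtLogSum N - Real.log (Real.log N)) atTop (𝓝 c) := by
  set l : ℕ → ℝ := fun i => Real.log ((i : ℝ) + 3) with hl
  have hlpos : ∀ i, 0 < l i := fun i => Real.log_pos (by
    have : (0 : ℝ) ≤ i := i.cast_nonneg
    linarith)
  have hlmono : Monotone l := fun i j hij => Real.log_le_log (by positivity) (by
    have : (i : ℝ) ≤ j := by exact_mod_cast hij
    linarith)
  -- Indices start at `n = 3` so that `log (n-1)` is positive and `log log (n-1)` is meaningful.
  set z : ℕ → ℝ := fun i => vonMangoldt (i + 3) / ((i : ℝ) + 3)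
    - (Real.log ((i : ℝ) + 3) - Real.log ((i : ℝ) + 2)) with hz
  have hzsum : ∀ n, ∑ i ∈ Finset.range n, z i
      = (∑ m ∈ Finset.Ioc 0 (n + 2), vonMangoldt m / m - Real.log (n + 2))
        - (∑ m ∈ Finset.Ioc 0 2, vonMangoldt m / m - Real.log 2) := fun n => by
    induction n with
    | zero => simp
    | succ n ih =>
      rw [Finset.sum_range_succ, ih, show n + 1 + 2 = (n + 2) + 1 by ring,
        ← Finset.insert_Ioc_right_eq_Ioc_add_one (Nat.zero_le _), Finset.sum_insert (by simp)]
      simp only [hz]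
      push_cast
      rw [show (n : ℝ) + 2 + 1 = n + 3 by ring, show (n : ℝ) + 1 + 2 = n + 3 by ring]
      ring_nf
  have hzb : ∀ n, ‖∑ i ∈ Finset.range n, z i‖ ≤ 2 * (Real.log 4 + 4) := fun n => by
    rw [hzsum, Real.norm_eq_abs]
    refine (abs_sub _ _).trans ?_
    have h1 := abs_sum_vonMangoldt_div_sub_log_le (N := n + 2) (by omega)
    have h2 := abs_sum_vonMangoldt_div_sub_log_le (N := 2) (by omega)
    push_cast at h1 h2
    linarith
  have hl0 : Tendsto (fun i => (l i)⁻¹) atTop (𝓝 0) :=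
    (Real.tendsto_log_atTop.comp
      (tendsto_atTop_add_const_right _ _ tendsto_natCast_atTop_atTop)).inv_tendsto_atTop
  obtain ⟨c1, hc1⟩ := cauchySeq_tendsto_of_complete
    (Antitone.cauchySeq_series_mul_of_tendsto_zero_of_bounded
      (fun i j hij => inv_anti₀ (hlpos i) (hlmono hij)) hl0 hzb)
  set w : ℕ → ℝ := fun i => (l i)⁻¹ * (Real.log ((i : ℝ) + 3) - Real.log ((i : ℝ) + 2))
    - (Real.log (Real.log ((i : ℝ) + 3)) - Real.log (Real.log ((i : ℝ) + 2))) with hw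
  have hwsum : Summable w := by
    have hb : ∀ i : ℕ, ‖w i‖ ≤ (Real.log 2 ^ 2)⁻¹ * (1 / ((i : ℝ) + 1) ^ 2) := fun i => by
      have hi : (0 : ℝ) ≤ i := i.cast_nonneg
      have h2 : 0 < Real.log 2 := Real.log_pos (by norm_num)
      have hu : Real.log 2 ≤ Real.log ((i : ℝ) + 2) := Real.log_le_log (by norm_num) (by linarith)
      have huv : Real.log ((i : ℝ) + 2) ≤ Real.log ((i : ℝ) + 3) :=
        Real.log_le_log (by linarith) (by linarith)
      have hd : Real.log ((i : ℝ) + 3) - Real.log ((i : ℝ) + 2) ≤ 1 / ((i : ℝ) + 1) := by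
        have := log_add_one_sub_log_le (x := (i : ℝ) + 2) (by linarith)
        rw [show (i : ℝ) + 2 + 1 = i + 3 by ring] at this
        exact this.trans (one_div_le_one_div_of_le (by linarith) (by linarith))
      have := abs_log_sub_log_div_sub_le (h2.trans_le hu) huv
      rw [Real.norm_eq_abs, hw]
      simp only [hl]
      rw [inv_mul_eq_div]
      refine this.trans ?_
      rw [inv_mul_eq_div]
      have e : (1 : ℝ) / ((i : ℝ) + 1) ^ 2 = (1 / ((i : ℝ) + 1)) ^ 2 := by rw [div_pow, one_pow]
      rw [e]
      have h3 : 0 ≤ Real.log ((i : ℝ) + 3) - Real.log ((i : ℝ) + 2) := by linarith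
      gcongr
    refine Summable.of_norm_bounded ?_ hb
    refine Summable.mul_left _ ?_
    have := (summable_nat_add_iff 1).2 (Real.summable_one_div_nat_pow (p := 2).2 (by norm_num))
    simpa using this
  have htot := hc1.add hwsum.hasSum.tendsto_sum_nat
  have hid : ∀ n, ∑ i ∈ Finset.range n, (l i)⁻¹ • z i + ∑ i ∈ Finset.range n, w i
      = (vonMangoldtLogSum (n + 2) - Real.log (Real.log (n + 2)))
        - (vonMangoldtLogSum 2 - Real.log (Real.log 2)) := fun n => by
    induction n with
    | zero => simp
    | succ n ih =>
      rw [Finset.sum_range_succ, Finset.sum_range_succ, add_add_add_comm, ih]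
      have : vonMangoldtLogSum (n + 1 + 2) = vonMangoldt (n + 3) / (((n : ℝ) + 3) * l n)
          + vonMangoldtLogSum (n + 2) := by
        unfold vonMangoldtLogSum
        rw [show n + 1 + 2 = (n + 2) + 1 by ring,
        ← Finset.insert_Ioc_right_eq_Ioc_add_one (Nat.zero_le _), Finset.sum_insert (by simp)]
        simp only [hl]
        push_cast
        rw [show (n : ℝ) + 2 + 1 = n + 3 by ring]
      rw [this]
      have hne := (hlpos n).ne'
      have hne' : (n : ℝ) + 3 ≠ 0 := by positivity
      simp only [hz, hw, smul_eq_mul]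
      push_cast
      rw [show (n : ℝ) + 1 + 2 = n + 3 by ring]
      field_simp
      ring
  simp_rw [hid] at htot
  refine ⟨c1 + ∑' i, w i + (vonMangoldtLogSum 2 - Real.log (Real.log 2)), ?_⟩
  rw [← tendsto_add_atTop_iff_nat 2]
  refine (htot.add_const (vonMangoldtLogSum 2 - Real.log (Real.log 2))).congr fun n => ?_
  push_cast
  ring

end Mertens

/-! ### Identification of the constant as Euler's. -/

section MertensConstant

open ArithmeticFunction Filter Topology MeasureTheory Set

theorem vonMangoldt_div_mul_log_nonneg (n : ℕ) : 0 ≤ vonMangoldt n / (n * Real.log n) :=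
  div_nonneg vonMangoldt_nonneg (mul_nonneg n.cast_nonneg (Real.log_natCast_nonneg n))

theorem vonMangoldtLogSum_nonneg (N : ℕ) : 0 ≤ vonMangoldtLogSum N :=
  Finset.sum_nonneg fun n _ => vonMangoldt_div_mul_log_nonneg n

theorem vonMangoldtLogSum_le (N : ℕ) : vonMangoldtLogSum N ≤ 1 + Real.log N := by
  have h := harmonic_le_one_add_log N
  rw [harmonic_eq_sum_Icc] at h
  push_cast at h
  refine le_trans ?_ h
  unfold vonMangoldtLogSum
  rw [show Finset.Icc 1 N = Finset.Ioc 0 N from rfl]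
  refine Finset.sum_le_sum fun n _ => ?_
  rcases eq_or_ne (Real.log n) 0 with h0 | h0
  · rw [h0]; simp
  rw [mul_comm, ← div_div, div_eq_mul_inv _ (n : ℝ)]
  refine mul_le_of_le_one_left (by positivity) ?_
  exact div_le_one_of_le₀ vonMangoldt_le_log (Real.log_natCast_nonneg n)

theorem vonMangoldtLogSum_isBigO {r : ℝ} (hr : 0 < r) :
    vonMangoldtLogSum =O[atTop] fun n : ℕ => (n : ℝ) ^ r := by
  have h1 : (fun n : ℕ => 1 + Real.log n) =O[atTop] fun n : ℕ => (n : ℝ) ^ r := by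
    have hlog : (fun x : ℝ => 1 + Real.log x) =O[atTop] fun x : ℝ => x ^ r := by
      refine Asymptotics.IsBigO.add ?_ (isLittleO_log_rpow_atTop hr).isBigO
      exact (Asymptotics.isLittleO_const_left.2
        (Or.inr (tendsto_norm_atTop_atTop.comp (tendsto_rpow_atTop hr)))).isBigO
    exact hlog.comp_tendsto tendsto_natCast_atTop_atTop
  refine Asymptotics.IsBigO.trans (Asymptotics.isBigO_of_le _ fun n => ?_) h1
  rw [Real.norm_of_nonneg (vonMangoldtLogSum_nonneg n)]
  exact (vonMangoldtLogSum_le n).trans (le_abs_self _)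

/-- Abel summation for `log ζ(1+σ) = ∑ Λ(n) / (n^(1+σ) log n)`, read as a Dirichlet series at `σ`.
-/
theorem log_riemannZeta_eq_mul_integral {σ : ℝ} (hσ : 0 < σ) :
    Real.log (riemannZeta ((1 + σ : ℝ) : ℂ)).re
      = σ * ∫ t in Ioi (1 : ℝ), vonMangoldtLogSum ⌊t⌋₊ * t ^ (-(σ + 1)) := by
  have h1 := LSeries_eq_mul_integral_of_nonneg
    (fun n : ℕ => vonMangoldt n / (n * Real.log n)) (r := σ / 2) (by positivity) (s := (σ : ℂ))
    (by rw [Complex.ofReal_re]; linarith)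
    (vonMangoldtLogSum_isBigO (by positivity)) vonMangoldt_div_mul_log_nonneg
  apply Complex.ofReal_injective
  rw [log_riemannZeta_eq (by linarith)]
  rw [LSeries_def₀ (by simp)] at h1
  have h2 : ((∑' n : ℕ, vonMangoldt n / ((n : ℝ) ^ (1 + σ) * Real.log n) : ℝ) : ℂ)
      = ∑' n : ℕ, ((vonMangoldt n / (n * Real.log n) : ℝ) : ℂ) / (n : ℂ) ^ (σ : ℂ) := by
    push_cast
    congr 1
    ext n
    rcases Nat.eq_zero_or_pos n with rfl | hn
    · simp
    have hn' : (0 : ℝ) < n := by exact_mod_cast hn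
    rw [Real.rpow_add hn', Real.rpow_one]
    rw [← Complex.ofReal_natCast, ← Complex.ofReal_cpow hn'.le]
    push_cast
    rw [div_div]
    ring
  rw [h2, h1]
  push_cast
  congr 1
  rw [← integral_complex_ofReal]
  refine setIntegral_congr_fun measurableSet_Ioi fun t ht => ?_
  have ht0 : (0 : ℝ) ≤ t := zero_le_one.trans (le_of_lt ht)
  simp only [vonMangoldtLogSum]
  push_cast
  rw [Complex.ofReal_cpow ht0]
  push_cast
  rfl

/-- The substitution `t = exp (v / σ)` makes the weight independent of `σ`, ready for a limit under
the integral. -/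
theorem integral_Ioi_one_eq_integral_exp (g : ℝ → ℝ) {σ : ℝ} (hσ : 0 < σ) :
    σ * ∫ t in Ioi (1 : ℝ), g t * t ^ (-(σ + 1))
      = ∫ v in Ioi (0 : ℝ), g (Real.exp (v / σ)) * Real.exp (-v) := by
  have himg : (fun v : ℝ => Real.exp (v / σ)) '' Ioi 0 = Ioi 1 := by
    ext t
    simp only [Set.mem_image, mem_Ioi]
    constructor
    · rintro ⟨v, hv, rfl⟩
      exact Real.one_lt_exp_iff.2 (by positivity)
    · intro ht
      refine ⟨σ * Real.log t, mul_pos hσ (Real.log_pos ht), ?_⟩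
      rw [mul_div_cancel_left₀ _ hσ.ne', Real.exp_log (by linarith)]
  have h := integral_image_eq_integral_abs_deriv_smul (s := Ioi (0 : ℝ))
    (f := fun v => Real.exp (v / σ)) (f' := fun v => Real.exp (v / σ) * (1 / σ)) measurableSet_Ioi
    (fun v _ => (((hasDerivAt_id v).div_const σ).exp).hasDerivWithinAt)
    (fun a _ b _ hab => by
      have := Real.exp_injective hab
      field_simp at this
      exact this)
    (fun t => g t * t ^ (-(σ + 1)))
  rw [himg] at h
  rw [h, ← integral_const_mul]
  refine setIntegral_congr_fun measurableSet_Ioi fun v _ => ?_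
  simp only [smul_eq_mul]
  rw [abs_of_nonneg (by positivity), ← Real.exp_mul]
  have : Real.exp (v / σ * -(σ + 1)) = Real.exp (-v) * (Real.exp (v / σ))⁻¹ := by
    rw [← Real.exp_neg, ← Real.exp_add]
    congr 1
    field_simp
    ring
  rw [this]
  field_simp

/-- This is `Γ'(1) = -γ`, with the Gamma integral differentiated under the integral sign. -/
theorem integral_log_mul_exp_neg :
    IntegrableOn (fun v : ℝ => Real.log v * Real.exp (-v)) (Ioi 0) ∧
      ∫ v in Ioi (0 : ℝ), Real.log v * Real.exp (-v) = -Real.eulerMascheroniConstant := by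
  have h1 := Complex.hasDerivAt_GammaIntegral (s := 1) (by simp)
  have h2 : HasDerivAt Complex.GammaIntegral (-(Real.eulerMascheroniConstant : ℂ)) 1 := by
    refine Complex.hasDerivAt_Gamma_one.congr_of_eventuallyEq ?_
    have : {s : ℂ | 0 < s.re} ∈ 𝓝 (1 : ℂ) :=
      (isOpen_lt continuous_const Complex.continuous_re).mem_nhds (by simp)
    filter_upwards [this] with s hs
    exact (Complex.Gamma_eq_integral hs).symm
  have h3 := h1.unique h2
  have h4 : ∫ v in Ioi (0 : ℝ), Real.log v * Real.exp (-v) = -Real.eulerMascheroniConstant := by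
    apply Complex.ofReal_injective
    rw [← integral_complex_ofReal]
    push_cast
    rw [← h3]
    refine setIntegral_congr_fun measurableSet_Ioi fun v _ => ?_
    simp
  refine ⟨?_, h4⟩
  -- A non-integrable function has integral 0 by convention, which contradicts the value `-γ ≠ 0`.
  by_contra hni
  have h5 := integral_undef hni
  rw [h4] at h5
  have := Real.one_half_lt_eulerMascheroniConstant
  linarith

theorem log_log_sub_log_log_floor {t : ℝ} (ht : 2 ≤ t) :
    |Real.log (Real.log t) - Real.log (Real.log ⌊t⌋₊)| ≤ Real.log 2 / Real.log ⌊t⌋₊ := by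
  have hN : 2 ≤ ⌊t⌋₊ := Nat.le_floor (by exact_mod_cast ht)
  have hN' : (2 : ℝ) ≤ (⌊t⌋₊ : ℝ) := by exact_mod_cast hN
  have hle : (⌊t⌋₊ : ℝ) ≤ t := Nat.floor_le (by linarith)
  have hlt : t ≤ 2 * ⌊t⌋₊ := by
    have := Nat.lt_floor_add_one t
    linarith
  have hl : 0 < Real.log ⌊t⌋₊ := Real.log_pos (by linarith)
  have hl2 : Real.log ⌊t⌋₊ ≤ Real.log t := Real.log_le_log (by linarith) hle
  have hl3 : Real.log t ≤ Real.log 2 + Real.log ⌊t⌋₊ := by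
    rw [← Real.log_mul (by norm_num) (by linarith)]
    exact Real.log_le_log (by linarith) hlt
  have hnn := Real.log_le_log hl hl2
  rw [abs_of_nonneg (by linarith), ← Real.log_div (hl.trans_le hl2).ne' hl.ne']
  refine (Real.log_le_sub_one_of_pos (div_pos (hl.trans_le hl2) hl)).trans ?_
  rw [div_sub_one hl.ne']
  gcongr
  linarith

theorem tendsto_vonMangoldtLogSum_floor {c : ℝ}
    (hc : Tendsto (fun N : ℕ => vonMangoldtLogSum N - Real.log (Real.log N)) atTop (𝓝 c)) :
    Tendsto (fun t : ℝ => vonMangoldtLogSum ⌊t⌋₊ - Real.log (Real.log t)) atTop (𝓝 c) := by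
  have h1 := hc.comp (tendsto_nat_floor_atTop (α := ℝ))
  have h2 : Tendsto (fun t : ℝ => Real.log (Real.log t) - Real.log (Real.log ⌊t⌋₊)) atTop (𝓝 0) := by
    refine squeeze_zero_norm' (a := fun t : ℝ => Real.log 2 / Real.log ⌊t⌋₊) ?_ ?_
    · filter_upwards [eventually_ge_atTop 2] with t ht
      exact log_log_sub_log_log_floor ht
    · exact (Real.tendsto_log_atTop.comp
        (tendsto_natCast_atTop_atTop.comp tendsto_nat_floor_atTop)).const_div_atTop _
  have h3 := h1.sub h2
  rw [sub_zero] at h3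
  refine h3.congr fun t => ?_
  simp only [Function.comp]
  ring

/-- Supplies the domination for the limit `σ → 0`. When `exp u < 2` the sum vanishes and the error
is `-log u`; otherwise convergence gives a constant bound. -/
theorem exists_abs_vonMangoldtLogSum_floor_exp_sub_log_le {c : ℝ}
    (hc : Tendsto (fun N : ℕ => vonMangoldtLogSum N - Real.log (Real.log N)) atTop (𝓝 c)) :
    ∃ C, 0 ≤ C ∧ ∀ u : ℝ, 0 < u →
      |vonMangoldtLogSum ⌊Real.exp u⌋₊ - Real.log u| ≤ C + max 0 (-Real.log u) := by
  obtain ⟨C, hC⟩ := hc.abs.bddAbove_range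
  have hC' : ∀ N : ℕ, |vonMangoldtLogSum N - Real.log (Real.log N)| ≤ C := fun N =>
    hC (mem_range_self N)
  have hC0 : 0 ≤ C := (abs_nonneg _).trans (hC' 0)
  refine ⟨C + 1, by linarith, fun u hu => ?_⟩
  rcases lt_or_ge (Real.exp u) 2 with h | h
  · have hfl : ⌊Real.exp u⌋₊ = 1 := by
      rw [Nat.floor_eq_iff (by positivity)]
      exact ⟨by simpa using hu.le, by norm_num; exact h⟩
    have h0 : vonMangoldtLogSum 1 = 0 := by simp [vonMangoldtLogSum]
    have hu1 : u ≤ 1 := by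
      have := Real.add_one_le_exp u
      linarith
    have hlog : Real.log u ≤ 0 := Real.log_nonpos hu.le hu1
    rw [hfl, h0, zero_sub, abs_neg, abs_of_nonpos hlog]
    have := le_max_right 0 (-Real.log u)
    linarith
  · have h1 := log_log_sub_log_log_floor h
    rw [Real.log_exp] at h1
    have h2 := hC' ⌊Real.exp u⌋₊
    have hN' : (2 : ℝ) ≤ (⌊Real.exp u⌋₊ : ℝ) := by exact_mod_cast Nat.le_floor (by exact_mod_cast h)
    have h3 : Real.log 2 / Real.log ⌊Real.exp u⌋₊ ≤ 1 :=
      div_le_one_of_le₀ (Real.log_le_log (by norm_num) hN') (Real.log_nonneg (by linarith))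
    have h4 := le_max_left 0 (-Real.log u)
    rw [abs_le] at *
    constructor <;> linarith [h1.1, h1.2, h2.1, h2.2]

/-- As `σ → 0+`, `log ζ(1+σ) + log σ` tends to 0. Written as an integral against `exp (-v)`, it also
tends to the integral of `c + log v`, which is `c - γ`. -/
theorem limit_vonMangoldtLogSum_eq_eulerMascheroni {c : ℝ}
    (hc : Tendsto (fun N : ℕ => vonMangoldtLogSum N - Real.log (Real.log N)) atTop (𝓝 c)) :
    c = Real.eulerMascheroniConstant := by
  obtain ⟨C, hC0, hC⟩ := exists_abs_vonMangoldtLogSum_floor_exp_sub_log_le hc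
  obtain ⟨hint, hval⟩ := integral_log_mul_exp_neg
  have hexp : IntegrableOn (fun v : ℝ => Real.exp (-v)) (Ioi 0) := integrableOn_exp_neg_Ioi 0
  have hmeas : ∀ σ : ℝ, Measurable fun v : ℝ => vonMangoldtLogSum ⌊Real.exp (v / σ)⌋₊ := fun σ =>
    (measurable_from_nat (f := vonMangoldtLogSum)).comp
      (Nat.measurable_floor.comp (Real.measurable_exp.comp (measurable_id.div_const σ)))
  have hbound : ∀ σ : ℝ, 0 < σ → σ < 1 → ∀ v : ℝ, 0 < v →
      ‖(vonMangoldtLogSum ⌊Real.exp (v / σ)⌋₊ + Real.log σ) * Real.exp (-v)‖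
        ≤ C * Real.exp (-v) + 2 * |Real.log v * Real.exp (-v)| := by
    intro σ hσ hσ1 v hv
    have h1 := hC (v / σ) (by positivity)
    rw [Real.log_div hv.ne' hσ.ne'] at h1
    -- For `σ < 1` the term `log σ` only lowers `-log (v / σ)`, so the bound is uniform in `σ`.
    have hls : Real.log σ ≤ 0 := Real.log_nonpos hσ.le hσ1.le
    have h2 : max 0 (-(Real.log v - Real.log σ)) ≤ |Real.log v| :=
      max_le (abs_nonneg _) (by have := neg_abs_le (Real.log v); linarith)
    have h3 : |vonMangoldtLogSum ⌊Real.exp (v / σ)⌋₊ + Real.log σ| ≤ C + 2 * |Real.log v| := by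
      have : vonMangoldtLogSum ⌊Real.exp (v / σ)⌋₊ + Real.log σ
          = (vonMangoldtLogSum ⌊Real.exp (v / σ)⌋₊ - (Real.log v - Real.log σ)) + Real.log v := by
        ring
      rw [this]
      refine (abs_add_le _ _).trans ?_
      linarith
    rw [norm_mul, abs_mul, Real.norm_eq_abs, Real.norm_eq_abs, abs_of_pos (Real.exp_pos _)]
    nlinarith [Real.exp_pos (-v)]
  have hlim : Tendsto (fun σ : ℝ => ∫ v in Ioi (0 : ℝ),
      (vonMangoldtLogSum ⌊Real.exp (v / σ)⌋₊ + Real.log σ) * Real.exp (-v)) (𝓝[>] 0)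
      (𝓝 (∫ v in Ioi (0 : ℝ), (c + Real.log v) * Real.exp (-v))) := by
    refine tendsto_integral_filter_of_dominated_convergence
      (fun v => C * Real.exp (-v) + 2 * |Real.log v * Real.exp (-v)|) ?_ ?_ ?_ ?_
    · exact Eventually.of_forall fun σ => (((hmeas σ).add_const _).mul
        (Real.measurable_exp.comp measurable_neg)).aestronglyMeasurable
    · filter_upwards [Ioo_mem_nhdsGT (zero_lt_one (α := ℝ))] with σ hσ
      exact (ae_restrict_iff' measurableSet_Ioi).2
        (Eventually.of_forall fun v hv => hbound σ hσ.1 hσ.2 v hv)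
    · exact (hexp.const_mul C).add (hint.abs.const_mul 2)
    · refine (ae_restrict_iff' measurableSet_Ioi).2 (Eventually.of_forall fun v hv => ?_)
      have hv' : (0 : ℝ) < v := hv
      refine Tendsto.mul_const _ ?_
      have ht : Tendsto (fun σ : ℝ => Real.exp (v / σ)) (𝓝[>] 0) atTop :=
        Real.tendsto_exp_atTop.comp (tendsto_inv_nhdsGT_zero.const_mul_atTop hv')
      have h1 := ((tendsto_vonMangoldtLogSum_floor hc).comp ht).add_const (Real.log v)
      refine h1.congr' ?_
      filter_upwards [self_mem_nhdsWithin] with σ hσ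
      have hσ' : (0 : ℝ) < σ := hσ
      simp only [Function.comp, Real.log_exp]
      rw [Real.log_div hv'.ne' hσ'.ne']
      ring
  have hrhs : ∫ v in Ioi (0 : ℝ), (c + Real.log v) * Real.exp (-v)
      = c - Real.eulerMascheroniConstant := by
    simp_rw [add_mul]
    rw [integral_add (hexp.const_mul c) hint, integral_const_mul, hval, integral_exp_neg_Ioi]
    simp
    ring
  have hlhs : Tendsto (fun σ : ℝ => ∫ v in Ioi (0 : ℝ),
      (vonMangoldtLogSum ⌊Real.exp (v / σ)⌋₊ + Real.log σ) * Real.exp (-v)) (𝓝[>] 0) (𝓝 0) := by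
    have hz : Tendsto (fun s : ℝ => Real.log (riemannZeta s).re + Real.log (s - 1)) (𝓝[>] 1)
        (𝓝 0) := (Asymptotics.isLittleO_one_iff ℝ).1
          log_riemannZeta_add_log_sub_isLittleO_ofReal
    have hs : Tendsto (fun σ : ℝ => 1 + σ) (𝓝[>] 0) (𝓝[>] 1) := by
      refine tendsto_nhdsWithin_iff.2 ⟨?_, ?_⟩
      · have : Tendsto (fun σ : ℝ => 1 + σ) (𝓝 0) (𝓝 (1 + 0)) :=
          (continuous_const.add continuous_id).tendsto 0
        rw [add_zero] at this
        exact this.mono_left nhdsWithin_le_nhds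
      · filter_upwards [self_mem_nhdsWithin] with σ hσ
        have : (0 : ℝ) < σ := hσ
        exact mem_Ioi.2 (by linarith)
    refine (hz.comp hs).congr' ?_
    filter_upwards [Ioo_mem_nhdsGT (zero_lt_one (α := ℝ))] with σ hσ
    simp only [Function.comp]
    rw [log_riemannZeta_eq_mul_integral hσ.1, add_sub_cancel_left,
      integral_Ioi_one_eq_integral_exp (fun t => vonMangoldtLogSum ⌊t⌋₊) hσ.1]
    have hi : IntegrableOn (fun v : ℝ =>
        (vonMangoldtLogSum ⌊Real.exp (v / σ)⌋₊ + Real.log σ) * Real.exp (-v)) (Ioi 0) := by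
      refine Integrable.mono' ((hexp.const_mul C).add (hint.abs.const_mul 2))
        (((hmeas σ).add_const _).mul
          (Real.measurable_exp.comp measurable_neg)).aestronglyMeasurable ?_
      exact (ae_restrict_iff' measurableSet_Ioi).2
        (Eventually.of_forall fun v hv => hbound σ hσ.1 hσ.2 v hv)
    have e : ∀ v : ℝ, vonMangoldtLogSum ⌊Real.exp (v / σ)⌋₊ * Real.exp (-v)
        = (vonMangoldtLogSum ⌊Real.exp (v / σ)⌋₊ + Real.log σ) * Real.exp (-v)
          - Real.log σ * Real.exp (-v) := fun v => by ring
    simp_rw [e]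
    rw [integral_sub hi (hexp.const_mul _), integral_const_mul, integral_exp_neg_Ioi]
    simp
  have := tendsto_nhds_unique hlim hlhs
  rw [hrhs] at this
  linarith

/-- Mertens' second theorem in von Mangoldt form, with its constant. -/
theorem tendsto_vonMangoldtLogSum_sub_log_log :
    Tendsto (fun N : ℕ => vonMangoldtLogSum N - Real.log (Real.log N)) atTop
      (𝓝 Real.eulerMascheroniConstant) := by
  obtain ⟨c, hc⟩ := tendsto_vonMangoldtLogSum_sub_log_log_of_dirichlet
  rwa [limit_vonMangoldtLogSum_eq_eulerMascheroni hc] at hc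

end MertensConstant

/-! ### Mertens' third theorem and the Euler product. -/

section MertensProduct

open ArithmeticFunction Filter Topology

theorem vonMangoldtLogSum_eq_sum_primesLE (N : ℕ) :
    vonMangoldtLogSum N = ∑ p ∈ Nat.primesLE N, ∑ i ∈ Finset.range (Nat.log p N),
      ((p : ℝ)⁻¹) ^ (i + 1) / ((i : ℝ) + 1) := by
  rw [Finset.sum_sigma']
  have h1 : vonMangoldtLogSum N = ∑ n ∈ (Finset.Ioc 0 N).filter IsPrimePow,
      vonMangoldt n / (n * Real.log n) := by
    unfold vonMangoldtLogSum
    rw [Finset.sum_filter]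
    refine Finset.sum_congr rfl fun n _ => ?_
    split_ifs with h
    · rfl
    · rw [vonMangoldt_eq_zero_iff.2 h, zero_div]
  rw [h1]
  symm
  refine Finset.sum_bij (fun x _ => x.1 ^ (x.2 + 1)) ?_ ?_ ?_ ?_
  · rintro ⟨p, i⟩ h
    simp only [Finset.mem_sigma, Nat.mem_primesLE, Finset.mem_range] at h
    obtain ⟨⟨hpN, hp⟩, hi⟩ := h
    rw [Finset.mem_filter, Finset.mem_Ioc]
    exact ⟨⟨pow_pos hp.pos _, Nat.pow_le_of_le_log (by have := hp.pos; omega) hi⟩,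
      hp.isPrimePow.pow (Nat.succ_ne_zero i)⟩
  · rintro ⟨p, i⟩ h ⟨q, j⟩ h' e
    simp only [Finset.mem_sigma, Nat.mem_primesLE, Finset.mem_range] at h h'
    obtain ⟨h1, h2⟩ := Nat.Prime.pow_inj' h.1.2 h'.1.2 (Nat.succ_ne_zero i) (Nat.succ_ne_zero j) e
    obtain rfl : i = j := by omega
    rw [h1]
  · intro n hn
    rw [Finset.mem_filter, Finset.mem_Ioc] at hn
    obtain ⟨⟨hn0, hnN⟩, hpp⟩ := hn
    obtain ⟨p, k, hp, hk, rfl⟩ := (isPrimePow_nat_iff n).1 hpp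
    have hpN : p ≤ N := (Nat.le_self_pow hk.ne' p).trans hnN
    refine ⟨⟨p, k - 1⟩, ?_, ?_⟩
    · simp only [Finset.mem_sigma, Nat.mem_primesLE, Finset.mem_range]
      refine ⟨⟨hpN, hp⟩, ?_⟩
      have := Nat.le_log_of_pow_le hp.one_lt hnN
      omega
    · simp only
      rw [Nat.sub_add_cancel hk]
  · rintro ⟨p, i⟩ h
    simp only [Finset.mem_sigma, Nat.mem_primesLE, Finset.mem_range] at h
    have hp := h.1.2
    have hlog : Real.log p ≠ 0 := (Real.log_pos (by exact_mod_cast hp.one_lt)).ne'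
    have hp0 : (p : ℝ) ≠ 0 := by exact_mod_cast hp.ne_zero
    have hi : (i : ℝ) + 1 ≠ 0 := by positivity
    rw [vonMangoldt_apply_pow (Nat.succ_ne_zero i), vonMangoldt_apply_prime hp]
    push_cast
    rw [Real.log_pow, inv_pow]
    push_cast
    field_simp

/-- The omitted Taylor tail starts at the first power of `p` exceeding `N`, whose exponent is at
least 2. The bound `1/N` gives the limit for each `p`, and `1/p²` the domination in the sum over
`p`. -/
theorem abs_neg_log_one_sub_inv_sub_sum_le {p N : ℕ} (hp : p.Prime) (hpN : p ≤ N) :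
    |-Real.log (1 - (p : ℝ)⁻¹) - ∑ i ∈ Finset.range (Nat.log p N),
      ((p : ℝ)⁻¹) ^ (i + 1) / ((i : ℝ) + 1)| ≤ 2 * min ((N : ℝ)⁻¹) (1 / (p : ℝ) ^ 2) := by
  have h2 : (2 : ℝ) ≤ p := by exact_mod_cast hp.two_le
  have hx0 : 0 < (p : ℝ)⁻¹ := by positivity
  have hx1 : (p : ℝ)⁻¹ ≤ 1 / 2 := by
    rw [one_div]; exact inv_anti₀ (by norm_num) h2
  have habs : |(p : ℝ)⁻¹| = (p : ℝ)⁻¹ := abs_of_pos hx0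
  have hN0 : N ≠ 0 := by have := hp.pos; omega
  have h := Real.abs_log_sub_add_sum_range_le (x := (p : ℝ)⁻¹) (by rw [habs]; linarith)
    (Nat.log p N)
  rw [habs] at h
  rw [← abs_neg]
  have e : -(-Real.log (1 - (p : ℝ)⁻¹) - ∑ i ∈ Finset.range (Nat.log p N),
      ((p : ℝ)⁻¹) ^ (i + 1) / ((i : ℝ) + 1)) = ∑ i ∈ Finset.range (Nat.log p N),
      ((p : ℝ)⁻¹) ^ (i + 1) / ((i : ℝ) + 1) + Real.log (1 - (p : ℝ)⁻¹) := by ring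
  rw [e]
  refine h.trans ?_
  have h3 : ((p : ℝ)⁻¹) ^ (Nat.log p N + 1) / (1 - (p : ℝ)⁻¹)
      ≤ 2 * ((p : ℝ)⁻¹) ^ (Nat.log p N + 1) := by
    rw [div_le_iff₀ (by linarith)]
    have := pow_pos hx0 (Nat.log p N + 1)
    nlinarith
  refine h3.trans ?_
  refine mul_le_mul_of_nonneg_left (le_min ?_ ?_) (by norm_num)
  · rw [inv_pow]
    refine inv_anti₀ (by exact_mod_cast Nat.pos_of_ne_zero hN0) ?_
    exact_mod_cast (Nat.lt_pow_succ_log_self hp.one_lt N).le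
  · rw [one_div, ← inv_pow]
    refine pow_le_pow_of_le_one hx0.le (by linarith) ?_
    have := Nat.le_log_of_pow_le hp.one_lt (show p ^ 1 ≤ N by rwa [pow_one])
    omega

theorem tendsto_sum_neg_log_sub_vonMangoldtLogSum :
    Tendsto (fun N : ℕ => ∑ p ∈ Nat.primesLE N, -Real.log (1 - (p : ℝ)⁻¹) - vonMangoldtLogSum N)
      atTop (𝓝 0) := by
  have hsum : Summable fun p : ℕ => 2 * (1 / (p : ℝ) ^ 2) :=
    (Real.summable_one_div_nat_pow.2 (by norm_num)).mul_left 2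
  have hle : ∀ N p : ℕ, 2 * min ((N : ℝ)⁻¹) (1 / (p : ℝ) ^ 2) ≤ 2 * (1 / (p : ℝ) ^ 2) :=
    fun N p => mul_le_mul_of_nonneg_left (min_le_right _ _) (by norm_num)
  have hnn : ∀ N p : ℕ, 0 ≤ 2 * min ((N : ℝ)⁻¹) (1 / (p : ℝ) ^ 2) := fun N p => by positivity
  have hlim : Tendsto (fun N : ℕ => ∑' p : ℕ, 2 * min ((N : ℝ)⁻¹) (1 / (p : ℝ) ^ 2)) atTop
      (𝓝 (∑' _ : ℕ, (0 : ℝ))) := by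
    refine tendsto_tsum_of_dominated_convergence hsum (fun p => ?_)
      (Eventually.of_forall fun N p => ?_)
    · have : Tendsto (fun N : ℕ => 2 * (N : ℝ)⁻¹) atTop (𝓝 0) := by
        simpa using (tendsto_inv_atTop_zero.comp tendsto_natCast_atTop_atTop).const_mul (2 : ℝ)
      exact squeeze_zero (fun N => hnn N p)
        (fun N => mul_le_mul_of_nonneg_left (min_le_left _ _) (by norm_num)) this
    · rw [Real.norm_of_nonneg (hnn N p)]
      exact hle N p
  rw [tsum_zero] at hlim
  refine squeeze_zero_norm (fun N => ?_) hlim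
  rw [vonMangoldtLogSum_eq_sum_primesLE, ← Finset.sum_sub_distrib, Real.norm_eq_abs]
  refine (Finset.abs_sum_le_sum_abs _ _).trans ?_
  calc _ ≤ ∑ p ∈ Nat.primesLE N, 2 * min ((N : ℝ)⁻¹) (1 / (p : ℝ) ^ 2) :=
        Finset.sum_le_sum fun p hp => abs_neg_log_one_sub_inv_sub_sum_le
          (Nat.prime_of_mem_primesLE hp) (Nat.le_of_mem_primesLE hp)
    _ ≤ _ := Summable.sum_le_tsum _ (fun p _ => hnn N p)
        (Summable.of_nonneg_of_le (hnn N) (hle N) hsum)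

theorem one_sub_inv_pos {p : ℕ} (hp : p.Prime) : 0 < 1 - (p : ℝ)⁻¹ :=
  sub_pos.2 (inv_lt_one_of_one_lt₀ (by exact_mod_cast hp.one_lt))

/-- Mertens' third theorem. -/
theorem tendsto_prod_inv_one_sub_inv_div_log :
    Tendsto (fun N : ℕ => (∏ p ∈ Nat.primesLE N, (1 - (p : ℝ)⁻¹)⁻¹) / Real.log N) atTop
      (𝓝 (Real.exp Real.eulerMascheroniConstant)) := by
  have h := (Real.continuous_exp.tendsto _).comp
    (tendsto_sum_neg_log_sub_vonMangoldtLogSum.add tendsto_vonMangoldtLogSum_sub_log_log)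
  rw [zero_add] at h
  refine h.congr' ?_
  filter_upwards [eventually_ge_atTop 2] with N hN
  have hl : 0 < Real.log N := Real.log_pos (by exact_mod_cast (by omega : 1 < N))
  simp only [Function.comp]
  rw [sub_add_sub_cancel, Real.exp_sub, Real.exp_log hl, Real.exp_sum]
  congr 1
  refine Finset.prod_congr rfl fun p hp => ?_
  rw [Real.exp_neg, Real.exp_log (one_sub_inv_pos (Nat.prime_of_mem_primesLE hp))]

theorem tendsto_prod_one_sub_inv_sq :
    Tendsto (fun N : ℕ => ∏ p ∈ Nat.primesLE N, (1 - ((p : ℝ) ^ 2)⁻¹)) atTop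
      (𝓝 (6 / Real.pi ^ 2)) := by
  have h := (riemannZeta_eulerProduct (s := 2) (by simp)).comp (tendsto_add_atTop_nat 1)
  rw [riemannZeta_two] at h
  have h2 := (Complex.continuous_re.tendsto _).comp h
  have e : ((Real.pi : ℂ) ^ 2 / 6).re = Real.pi ^ 2 / 6 := by
    have : ((Real.pi : ℂ) ^ 2 / 6) = ((Real.pi ^ 2 / 6 : ℝ) : ℂ) := by push_cast; rfl
    rw [this, Complex.ofReal_re]
  rw [e] at h2
  have h3 := h2.inv₀ (by positivity)
  rw [inv_div] at h3
  refine h3.congr fun N => ?_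
  simp only [Function.comp]
  rw [show Nat.primesBelow (N + 1) = Nat.primesLE N from rfl]
  have : ∏ p ∈ Nat.primesLE N, (1 - (p : ℂ) ^ (-2 : ℂ))⁻¹
      = ((∏ p ∈ Nat.primesLE N, (1 - ((p : ℝ) ^ 2)⁻¹)⁻¹ : ℝ) : ℂ) := by
    push_cast
    refine Finset.prod_congr rfl fun p _ => ?_
    rw [Complex.cpow_neg]
    norm_cast
  rw [this, Complex.ofReal_re, Finset.prod_inv_distrib, inv_inv]

/-- Uses `(1 + x) / (1 - x) = (1 - x²) / (1 - x)²` with `x = 1/p`. -/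
theorem tendsto_poissonEulerProduct_div_log_sq :
    Tendsto (fun N : ℕ => poissonEulerProduct N / Real.log N ^ 2) atTop
      (𝓝 (6 * Real.exp (2 * Real.eulerMascheroniConstant) / Real.pi ^ 2)) := by
  have h := tendsto_prod_one_sub_inv_sq.mul (tendsto_prod_inv_one_sub_inv_div_log.pow 2)
  have e : 6 / Real.pi ^ 2 * Real.exp Real.eulerMascheroniConstant ^ 2
      = 6 * Real.exp (2 * Real.eulerMascheroniConstant) / Real.pi ^ 2 := by
    rw [two_mul, Real.exp_add]; ring
  rw [e] at h
  refine h.congr fun N => ?_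
  rw [div_pow, ← mul_div_assoc, ← Finset.prod_pow, ← Finset.prod_mul_distrib]
  congr 1
  refine Finset.prod_congr rfl fun p hp => ?_
  have := (one_sub_inv_pos (Nat.prime_of_mem_primesLE hp)).ne'
  rw [← inv_pow]
  generalize (p : ℝ)⁻¹ = x at this ⊢
  field_simp
  ring

end MertensProduct

/-! ### Choice of parameters and the two bounds. -/

section Main

open Filter Topology

theorem gcdSum_le_sq {k : ℕ} (n : Fin k → ℕ) : gcdSum n ≤ (k : ℝ) ^ 2 := by
  have h : ∀ i j, ((Nat.gcd (n i) (n j) : ℝ) ^ 2) / ((n i : ℝ) * (n j : ℝ)) ≤ 1 := fun i j => by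
    rcases Nat.eq_zero_or_pos (n i) with hi | hi
    · simp [hi]
    rcases Nat.eq_zero_or_pos (n j) with hj | hj
    · simp [hj]
    refine div_le_one_of_le₀ ?_ (by positivity)
    rw [sq]
    exact_mod_cast Nat.mul_le_mul (Nat.gcd_le_left _ hi) (Nat.gcd_le_right _ hj)
  unfold gcdSum
  refine (Finset.sum_le_sum fun i _ => Finset.sum_le_sum fun j _ => h i j).trans ?_
  simp [sq]

theorem bddAbove_normalizedGcdSums (k : ℕ) : BddAbove (normalizedGcdSums k) := by
  refine ⟨1 / ((k : ℝ) * (Real.log (Real.log (k : ℝ))) ^ 2) * (k : ℝ) ^ 2, ?_⟩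
  rintro x ⟨n, -, -, rfl⟩
  exact mul_le_mul_of_nonneg_left (gcdSum_le_sq n) (by positivity)

theorem normalizedGcdSums_nonempty (k : ℕ) : (normalizedGcdSums k).Nonempty := by
  obtain ⟨n, h1, h2, -⟩ := exists_strictMono_le_gcdSum k 0 le_rfl
  exact ⟨_, n, h1, h2, rfl⟩

/-- The Euler product depends on its cutoff asymptotically only through the logarithm, so a constant
factor or a factor `log L` in the cutoff is invisible. -/
theorem tendsto_log_div_log_of_abs_sub_le {α : Type*} {l : Filter α} {Y L : α → ℝ} {C : ℝ}
    (hL : Tendsto L l atTop)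
    (h : ∀ᶠ a in l, |Real.log (Y a) - Real.log (L a)| ≤ C + Real.log (Real.log (L a))) :
    Tendsto (fun a => Real.log (Y a) / Real.log (L a)) l (𝓝 1) := by
  have hlog := Real.tendsto_log_atTop.comp hL
  have h1 : Tendsto (fun a => (C + Real.log (Real.log (L a))) / Real.log (L a)) l (𝓝 0) := by
    have h2 : Tendsto (fun x : ℝ => Real.log x / x) atTop (𝓝 0) :=
      Real.isLittleO_log_id_atTop.tendsto_div_nhds_zero
    have h3 := (hlog.const_div_atTop C).add (h2.comp hlog)
    rw [add_zero] at h3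
    exact h3.congr fun a => by simp only [Function.comp]; rw [add_div]
  have h4 : Tendsto (fun a => (Real.log (Y a) - Real.log (L a)) / Real.log (L a)) l (𝓝 0) := by
    refine squeeze_zero_norm' ?_ h1
    filter_upwards [h, hlog.eventually_gt_atTop 0] with a ha hpos
    simp only [Function.comp] at hpos
    rw [norm_div, Real.norm_of_nonneg hpos.le, Real.norm_eq_abs]
    gcongr
  have h5 := h4.const_add 1
  rw [add_zero] at h5
  refine h5.congr' ?_
  filter_upwards [hlog.eventually_gt_atTop 0] with a hpos
  simp only [Function.comp] at hpos
  field_simp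
  ring

theorem tendsto_log_natCast_atTop : Tendsto (fun k : ℕ => Real.log (k : ℝ)) atTop atTop :=
  Real.tendsto_log_atTop.comp tendsto_natCast_atTop_atTop

theorem tendsto_log_log_natCast_atTop :
    Tendsto (fun k : ℕ => Real.log (Real.log (k : ℝ))) atTop atTop :=
  Real.tendsto_log_atTop.comp tendsto_log_natCast_atTop

theorem tendsto_poissonEulerProduct_div_log_log_sq {y : ℕ → ℕ} (hy : Tendsto y atTop atTop)
    (h : Tendsto (fun k : ℕ => Real.log (y k) / Real.log (Real.log k)) atTop (𝓝 1)) :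
    Tendsto (fun k : ℕ => poissonEulerProduct (y k) / Real.log (Real.log k) ^ 2) atTop
      (𝓝 (6 * Real.exp (2 * Real.eulerMascheroniConstant) / Real.pi ^ 2)) := by
  have h1 := (tendsto_poissonEulerProduct_div_log_sq.comp hy).mul (h.pow 2)
  rw [one_pow, mul_one] at h1
  refine h1.congr' ?_
  have h2 := (tendsto_log_natCast_atTop.comp hy).eventually_gt_atTop 0
  filter_upwards [h2] with k hk
  simp only [Function.comp] at hk ⊢
  field_simp

theorem tendsto_ceil_mul_log {B : ℝ} (hB : 0 < B) :
    Tendsto (fun k : ℕ => ⌈B * Real.log k⌉₊) atTop atTop :=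
  tendsto_nat_ceil_atTop.comp (tendsto_log_natCast_atTop.const_mul_atTop hB)

theorem tendsto_log_ceil_mul_log_div {B : ℝ} (hB : 0 < B) :
    Tendsto (fun k : ℕ => Real.log (⌈B * Real.log k⌉₊ : ℕ) / Real.log (Real.log k)) atTop (𝓝 1) := by
  refine tendsto_log_div_log_of_abs_sub_le (C := |Real.log B| + Real.log 2)
    tendsto_log_natCast_atTop ?_
  filter_upwards [(tendsto_log_natCast_atTop.const_mul_atTop hB).eventually_ge_atTop 1,
    tendsto_log_natCast_atTop.eventually_gt_atTop 0,
    (Real.tendsto_log_atTop.comp tendsto_log_log_natCast_atTop).eventually_ge_atTop 0]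
    with k h1 h2 h3
  simp only [Function.comp] at h3
  have hc1 := Nat.le_ceil (B * Real.log k)
  have hc2 : (⌈B * Real.log k⌉₊ : ℝ) ≤ 2 * (B * Real.log k) := by
    have := Nat.ceil_lt_add_one (a := B * Real.log k) (by linarith)
    linarith
  have hl1 := Real.log_le_log (by linarith) hc1
  have hl2 := Real.log_le_log (by linarith) hc2
  rw [Real.log_mul (by norm_num) (by positivity)] at hl2
  rw [Real.log_mul hB.ne' h2.ne'] at hl1 hl2
  have h5 := le_abs_self (Real.log B)
  have h6 := neg_abs_le (Real.log B)
  have h7 : 0 < Real.log 2 := Real.log_pos (by norm_num)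
  rw [abs_le]
  constructor <;> linarith

/-- With `q` about `4 log k / log a`, `a^q ≥ k⁴`. As `q + 1 ≤ D log k`, the cutoff `12 D² log k`
keeps the exponential at most `k`, so the excess is at most `k² · k / k⁴ ≤ 1` after factoring out
the Euler product. -/
theorem eventually_gcdSum_le {a : ℝ} (ha : 1 < a) :
    ∃ B : ℝ, 0 < B ∧ ∀ᶠ k : ℕ in atTop, ∀ n : Fin k → ℕ, Function.Injective n →
      (∀ i, n i ≠ 0) →
      gcdSum n ≤ poissonEulerProduct ⌈B * Real.log k⌉₊ * (a * k + 1) := by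
  have hl : 0 < Real.log a := Real.log_pos ha
  set D : ℝ := 4 / Real.log a + 2 with hD
  have hD0 : 0 < D := by positivity
  refine ⟨12 * D ^ 2, by positivity, ?_⟩
  filter_upwards [(tendsto_ceil_mul_log (B := 12 * D ^ 2) (by positivity)).eventually_ge_atTop 4,
    tendsto_log_natCast_atTop.eventually_ge_atTop 1, eventually_ge_atTop 1] with k hy hL hk n hn hn0
  have hk0 : (0 : ℝ) < k := by exact_mod_cast hk
  set L := Real.log k with hLdef
  set q := ⌈4 * L / Real.log a⌉₊ with hq
  have hq1 : 4 * L / Real.log a ≤ q := Nat.le_ceil _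
  have hq2 : (q : ℝ) + 1 ≤ D * L := by
    have := Nat.ceil_lt_add_one (a := 4 * L / Real.log a) (by positivity)
    have e : D * L = 4 * L / Real.log a + 2 * L := by rw [hD]; ring
    linarith
  have hexpL : Real.exp L = k := Real.exp_log hk0
  have haq : (k : ℝ) ^ 4 ≤ a ^ q := by
    have h1 : 4 * L ≤ q * Real.log a := (div_le_iff₀ hl).1 hq1
    calc (k : ℝ) ^ 4 = Real.exp (4 * L) := by
          rw [← hexpL, ← Real.exp_nat_mul]; norm_num
      _ ≤ Real.exp (q * Real.log a) := Real.exp_le_exp.2 h1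
      _ = a ^ q := by rw [Real.exp_nat_mul, Real.exp_log (by linarith)]
  have hexp : Real.exp (12 * ((q : ℝ) + 1) ^ 2 / ⌈12 * D ^ 2 * L⌉₊) ≤ k := by
    rw [← hexpL, Real.exp_le_exp]
    have hyp : 0 < 12 * D ^ 2 * L := by positivity
    rw [div_le_iff₀ (hyp.trans_le (Nat.le_ceil _))]
    calc 12 * ((q : ℝ) + 1) ^ 2 ≤ 12 * (D * L) ^ 2 := by gcongr
      _ = L * (12 * D ^ 2 * L) := by ring
      _ ≤ _ := by gcongr; exact Nat.le_ceil _
  have hrem : (k : ℝ) ^ 2 / a ^ q * Real.exp (12 * ((q : ℝ) + 1) ^ 2 / ⌈12 * D ^ 2 * L⌉₊) ≤ 1 := by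
    calc (k : ℝ) ^ 2 / a ^ q * Real.exp (12 * ((q : ℝ) + 1) ^ 2 / ⌈12 * D ^ 2 * L⌉₊)
        ≤ (k : ℝ) ^ 2 / (k : ℝ) ^ 4 * k := by gcongr
      _ = 1 / (k : ℝ) := by field_simp
      _ ≤ 1 := div_le_one_of_le₀ (by exact_mod_cast hk) hk0.le
  exact (gcdSum_le hn hn0 hy (by linarith : 0 < a) q).trans
    (mul_le_mul_of_nonneg_left (by linarith) (poissonEulerProduct_pos _).le)

theorem eventually_sSup_normalizedGcdSums_lt {b : ℝ}
    (hb : 6 * Real.exp (2 * Real.eulerMascheroniConstant) / Real.pi ^ 2 < b) :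
    ∀ᶠ k : ℕ in atTop, sSup (normalizedGcdSums k) < b := by
  set c : ℝ := 6 * Real.exp (2 * Real.eulerMascheroniConstant) / Real.pi ^ 2 with hc
  have hc0 : 0 < c := by positivity
  obtain ⟨a, ha1, ha2⟩ := exists_between ((one_lt_div hc0).2 hb)
  rw [lt_div_iff₀ hc0] at ha2
  obtain ⟨B, hB, hev⟩ := eventually_gcdSum_le ha1
  have hlim := (tendsto_poissonEulerProduct_div_log_log_sq (tendsto_ceil_mul_log hB)
    (tendsto_log_ceil_mul_log_div hB)).mul
    ((tendsto_one_div_atTop_nhds_zero_nat (𝕜 := ℝ)).const_add a)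
  rw [add_zero, mul_comm] at hlim
  filter_upwards [hev, hlim.eventually_lt_const ha2, eventually_ge_atTop 1] with k h1 h2 hk
  refine lt_of_le_of_lt (csSup_le (normalizedGcdSums_nonempty k) ?_) h2
  rintro x ⟨n, hmono, hn1, rfl⟩
  have hk0 : (0 : ℝ) < k := by exact_mod_cast hk
  calc 1 / ((k : ℝ) * Real.log (Real.log k) ^ 2) * gcdSum n
      ≤ 1 / ((k : ℝ) * Real.log (Real.log k) ^ 2) *
        (poissonEulerProduct ⌈B * Real.log k⌉₊ * (a * k + 1)) :=
        mul_le_mul_of_nonneg_left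
          (h1 n hmono.injective fun i => by have := hn1 i; omega) (by positivity)
    _ = poissonEulerProduct ⌈B * Real.log k⌉₊ / Real.log (Real.log k) ^ 2 * (a + 1 / k) := by
        rw [show a + 1 / (k : ℝ) = (a * k + 1) / k by field_simp]
        rw [div_mul_div_comm, mul_comm (Real.log (Real.log k) ^ 2)]
        ring

/-- The cutoff for the primes used in the extremal construction. -/
noncomputable def extremalCutoff (k : ℕ) : ℕ :=
  ⌊Real.log k / (4 * Real.log (Real.log k))⌋₊

theorem tendsto_div_four_mul_log_atTop :
    Tendsto (fun x : ℝ => x / (4 * Real.log x)) atTop atTop := by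
  have h2 : Tendsto (fun x : ℝ => Real.log x / x) atTop (𝓝[>] 0) := by
    refine tendsto_nhdsWithin_iff.2 ⟨Real.isLittleO_log_id_atTop.tendsto_div_nhds_zero, ?_⟩
    filter_upwards [eventually_gt_atTop 1] with x hx
    exact Set.mem_Ioi.2 (div_pos (Real.log_pos hx) (by linarith))
  have h3 := (tendsto_inv_nhdsGT_zero.comp h2).const_mul_atTop (show (0 : ℝ) < 1 / 4 by norm_num)
  refine h3.congr fun x => ?_
  simp only [Function.comp, inv_div]
  ring

theorem tendsto_extremalCutoff : Tendsto extremalCutoff atTop atTop :=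
  tendsto_nat_floor_atTop.comp (tendsto_div_four_mul_log_atTop.comp tendsto_log_natCast_atTop)

theorem tendsto_log_extremalCutoff_div :
    Tendsto (fun k : ℕ => Real.log (extremalCutoff k) / Real.log (Real.log k)) atTop (𝓝 1) := by
  refine tendsto_log_div_log_of_abs_sub_le (C := Real.log 8) tendsto_log_natCast_atTop ?_
  filter_upwards [(tendsto_div_four_mul_log_atTop.comp tendsto_log_natCast_atTop).eventually_ge_atTop
      1, tendsto_log_natCast_atTop.eventually_gt_atTop 0,
    tendsto_log_log_natCast_atTop.eventually_ge_atTop 1] with k h1 h2 h3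
  simp only [Function.comp] at h1
  set L := Real.log k
  have hf1 : (extremalCutoff k : ℝ) ≤ L / (4 * Real.log L) := Nat.floor_le (by linarith)
  have hf2 : L / (4 * Real.log L) ≤ 2 * extremalCutoff k := by
    have h4 := Nat.lt_floor_add_one (L / (4 * Real.log L))
    have h5 : (1 : ℝ) ≤ (⌊L / (4 * Real.log L)⌋₊ : ℝ) := by
      exact_mod_cast Nat.le_floor (by exact_mod_cast h1)
    unfold extremalCutoff
    linarith
  have hy0 : (0 : ℝ) < extremalCutoff k := by linarith
  have hle : L / (4 * Real.log L) ≤ L := div_le_self h2.le (by linarith)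
  have hl1 := Real.log_le_log hy0 (hf1.trans hle)
  have hl2 : L ≤ 8 * Real.log L * extremalCutoff k := by
    rw [div_le_iff₀ (by linarith)] at hf2
    linarith
  have hl3 := Real.log_le_log h2 hl2
  rw [Real.log_mul (by positivity) hy0.ne', Real.log_mul (by norm_num) (by linarith)] at hl3
  rw [abs_le]
  have h8 : 0 ≤ Real.log 8 := Real.log_nonneg (by norm_num)
  have h9 : 0 ≤ Real.log (Real.log L) := Real.log_nonneg h3
  constructor <;> linarith

/-- Taking `M = y²` makes the loss from truncated exponents `y · 2/M = 2/y`. The cutoff keeps the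
grid size `s` below `√k`, so rounding `k` to a multiple of `s` loses a proportion at most
`k^(-1/2)`. -/
theorem eventually_le_sSup_normalizedGcdSums :
    ∀ᶠ k : ℕ in atTop, (1 - Real.exp (-(Real.log k / 2))) * (1 - 2 / extremalCutoff k) *
      (poissonEulerProduct (extremalCutoff k) / Real.log (Real.log k) ^ 2)
        ≤ sSup (normalizedGcdSums k) := by
  filter_upwards [tendsto_extremalCutoff.eventually_ge_atTop 2,
    tendsto_log_natCast_atTop.eventually_gt_atTop 0,
    tendsto_log_log_natCast_atTop.eventually_ge_atTop 1, eventually_ge_atTop 1] with k hy hL hLL hk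
  have hk0 : (0 : ℝ) < k := by exact_mod_cast hk
  set L := Real.log k with hLdef
  have hexpL : Real.exp L = k := Real.exp_log hk0
  have hf1 : (extremalCutoff k : ℝ) ≤ L / (4 * Real.log L) := Nat.floor_le (by positivity)
  set y := extremalCutoff k with hydef
  have hy2 : (2 : ℝ) ≤ y := by exact_mod_cast hy
  have hM : 2 ≤ y ^ 2 := by nlinarith
  obtain ⟨n, hmono, hn1, hlow⟩ := exists_strictMono_le_gcdSum k y (M := y ^ 2) (by omega)
  set s : ℕ := (y ^ 2) ^ (Nat.primesLE y).card with hs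
  have hspos : 0 < s := pow_pos (by omega) _
  have hs0 : (0 : ℝ) < s := by exact_mod_cast hspos
  have hcard : (Nat.primesLE y).card ≤ y := by
    rw [Nat.primesLE_eq_filter_Ioc_zero]
    exact (Finset.card_filter_le _ _).trans (by simp)
  -- At most `y` primes occur, so `log s ≤ 2 y log y ≤ 2 y log L ≤ L / 2` by the choice of cutoff.
  have hsexp : (s : ℝ) ≤ Real.exp (L / 2) := by
    have hyL : Real.log y ≤ Real.log L :=
      Real.log_le_log (by linarith) (hf1.trans (div_le_self hL.le (by linarith)))
    have h1 : (s : ℝ) ≤ ((y : ℝ) ^ 2) ^ y := by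
      rw [hs]; push_cast
      exact pow_le_pow_right₀ (by nlinarith) hcard
    refine h1.trans ?_
    rw [← pow_mul, ← Real.log_le_iff_le_exp (by positivity), Real.log_pow]
    rw [le_div_iff₀ (by linarith)] at hf1
    push_cast
    nlinarith
  have hprod := mul_poissonEulerProduct_le_prod_toeplitzSum (y := y) hM
  have hMy : (y : ℝ) * (2 / ((y ^ 2 : ℕ) : ℝ)) = 2 / y := by
    push_cast; field_simp
  have hcast : ((y ^ 2 : ℕ) : ℝ) ^ (Nat.primesLE y).card = (s : ℝ) := by rw [hs]; push_cast; rfl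
  rw [hMy, hcast] at hprod
  have hfloor : (k : ℝ) - s ≤ ((k / s : ℕ) : ℝ) * s := by
    have h1 : k < s * (k / s + 1) := Nat.lt_mul_div_succ k hspos
    have h2 : (k : ℝ) < s * (((k / s : ℕ) : ℝ) + 1) := by exact_mod_cast h1
    linarith
  have hfac : 0 ≤ (1 - 2 / (y : ℝ)) * poissonEulerProduct y := by
    refine mul_nonneg ?_ (poissonEulerProduct_pos y).le
    rw [sub_nonneg]
    exact div_le_one_of_le₀ hy2 (by linarith)
  have hmain : (k : ℝ) * ((1 - Real.exp (-(L / 2))) * ((1 - 2 / (y : ℝ)) * poissonEulerProduct y))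
      ≤ gcdSum n := by
    refine le_trans ?_ hlow
    have h1 : (k : ℝ) * (1 - Real.exp (-(L / 2))) ≤ k - s := by
      have : (k : ℝ) * Real.exp (-(L / 2)) = Real.exp (L / 2) := by
        rw [← hexpL, ← Real.exp_add]; ring_nf
      linarith
    calc (k : ℝ) * ((1 - Real.exp (-(L / 2))) * ((1 - 2 / (y : ℝ)) * poissonEulerProduct y))
        = (k : ℝ) * (1 - Real.exp (-(L / 2))) * ((1 - 2 / (y : ℝ)) * poissonEulerProduct y) := by
          ring
      _ ≤ ((k / s : ℕ) : ℝ) * s * ((1 - 2 / (y : ℝ)) * poissonEulerProduct y) :=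
          mul_le_mul_of_nonneg_right (h1.trans hfloor) hfac
      _ = ((k / s : ℕ) : ℝ) * (s * ((1 - 2 / (y : ℝ)) * poissonEulerProduct y)) := by ring
      _ ≤ _ := mul_le_mul_of_nonneg_left hprod (Nat.cast_nonneg _)
  refine le_trans ?_ (le_csSup (bddAbove_normalizedGcdSums k) ⟨n, hmono, hn1, rfl⟩)
  rw [one_div, inv_mul_eq_div, le_div_iff₀ (by positivity)]
  refine le_trans (le_of_eq ?_) hmain
  have hne : Real.log L ≠ 0 := by linarith
  rw [← hLdef]
  field_simp

theorem tendsto_lower_bound :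
    Tendsto (fun k : ℕ => (1 - Real.exp (-(Real.log k / 2))) * (1 - 2 / extremalCutoff k) *
      (poissonEulerProduct (extremalCutoff k) / Real.log (Real.log k) ^ 2)) atTop
      (𝓝 (6 * Real.exp (2 * Real.eulerMascheroniConstant) / Real.pi ^ 2)) := by
  have h1 : Tendsto (fun k : ℕ => 1 - Real.exp (-(Real.log k / 2))) atTop (𝓝 1) := by
    have := (Real.tendsto_exp_neg_atTop_nhds_zero.comp
      (tendsto_log_natCast_atTop.atTop_div_const (show (0 : ℝ) < 2 by norm_num))).const_sub 1
    simpa using this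
  have h2 : Tendsto (fun k : ℕ => 1 - 2 / (extremalCutoff k : ℝ)) atTop (𝓝 1) := by
    have := ((tendsto_natCast_atTop_atTop.comp tendsto_extremalCutoff).const_div_atTop
      (2 : ℝ)).const_sub 1
    simpa using this
  have h3 := (h1.mul h2).mul (tendsto_poissonEulerProduct_div_log_log_sq tendsto_extremalCutoff
    tendsto_log_extremalCutoff_div)
  rwa [one_mul, one_mul] at h3

end Main

theorem theorem1 :
    (∀ k : ℕ, BddAbove (normalizedGcdSums k)) ∧
      Filter.Tendsto (fun k : ℕ => sSup (normalizedGcdSums k)) Filter.atTop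
        (nhds (6 * Real.exp (2 * Real.eulerMascheroniConstant) / Real.pi ^ 2)) := by
  refine ⟨bddAbove_normalizedGcdSums, tendsto_order.2 ⟨fun b hb => ?_, fun b hb =>
    eventually_sSup_normalizedGcdSums_lt hb⟩⟩
  filter_upwards [eventually_le_sSup_normalizedGcdSums,
    tendsto_lower_bound.eventually_const_lt hb] with k h1 h2
  exact h2.trans_le h1
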